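/- Let $A=(a_{ij})\in\mathbb C^{7\times 7}$ be a reciprocal matrix with zero main diagonal ($A\in\mathbf{RM}_7$): $a_{ii}=0$, $a_{ij}=0$ if $|i-j|>1$, and $a_{i,i+1}a_{i+1,i}=1$ for $i=1,\dots,6$. Put $\xi_j=(|a_{j,j+1}|-|a_{j+1,j}|)^2/4$, $j=1,\dots,6$. Let $C(A)$ be the Kippenhahn curve of $A$, i.e. the envelope of the family of lines $e^{-i\theta}(\lambda(\theta)+i\mathbb R)$, $\theta\in\mathbb R$, where $\lambda(\theta)$ runs through the (real analytic branches of the) roots of $P_A(\lambda,\theta)=\det(\operatorname{Re}(e^{i\theta}A)-\lambda I)$; it consists of the points $e^{-i\theta}(\lambda(\theta)-i\lambda'(\theta))$. Ellipses are understood to have positive minor half-axis. Define \[\begin{aligned} \vec\xi_1&=\Bigl(1,\,0,\,7\sqrt2-4\sqrt{7\sqrt2+10}+9,\,-2\bigl(\sqrt2+2\sqrt{4-2\sqrt2}-4\bigr),\\ &\qquad 8\sqrt2-6\sqrt{2(\sqrt2+2)}+5,\,2\bigl(-2\sqrt2+\sqrt{14\sqrt2+20}-3\bigr)\Bigr)\\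 &\approx(1,0,1.05595,0.842004,0.634953,0.960434),\\ \vec\xi_2&=\Bigl(1,\,0,\,2\sqrt{2-\sqrt2}-\tfrac3{\sqrt2}+2,\,2\sqrt{\sqrt2+2}-\tfrac1{\sqrt2}-2,\\ &\qquad -2\bigl(\sqrt2+2\sqrt{4-2\sqrt2}-4\bigr),\,6\sqrt2+4\sqrt{10-7\sqrt2}-9\Bigr)\\ &\approx(1,0,1.40941,0.988411,0.842004,0.753383),\\ \vec\xi_3&=\tfrac1u\Bigl(u,\,1-u,\,0,\,8-2\sqrt2-4b,\,\tfrac72\sqrt2-2-2\sqrt2\,b,\,1+\tfrac{\sqrt2}2\Bigr)\\ &\approx(1,0.447769,0,1.21903,-0.161745,2.4715), \end{aligned}\] where $b=\sqrt{4-2\sqrt2}$ and $u=(2+2\sqrt2)b-1-\tfrac52\sqrt2$, and let $\vec\xi_{3+i}$ be the reversal of $\vec\xi_i$ (under $\xi_j\leftrightarrow\xi_{7-j}$), $i=1,2,3$. (The decimal values are correct to within $5\cdot10^{-6}$.) Put \[c_1=c_4=1,\quad d_1=d_4=\sqrt{9\sqrt2-4\sqrt{14\sqrt2+20}+15},\qquad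 c_2=c_5=1,\quad d_2=d_5=\sqrt{2\bigl(\sqrt2+\sqrt{4-2\sqrt2}-1\bigr)},\] \[c_3=c_6=u^{-1/2}\approx1.20323,\qquad d_3=d_6=\sqrt{\bigl(6+2\sqrt2-(4+2\sqrt2)b\bigr)/u}\approx1.44257.\] Then $C(A)$ contains an ellipse $E$ with the foci $\sqrt{2-\sqrt2}$ and $-\sqrt2$ (equivalently, an ellipse with the foci $\sqrt2$ and $-\sqrt{2-\sqrt2}$) if and only if $(\xi_1,\dots,\xi_6)=t\,\vec\xi_j$ for some $t>0$ and some $j\in\{1,\dots,6\}$. If this is the case, then $E$ has minor half-axis $\sqrt t\,c_j$, and \[C(A)=E\cup(-E)\cup E_0\cup\{0\},\] where $E_0$ is the ellipse with the foci $\pm\sqrt{2+\sqrt2}$ and minor half-axis $\sqrt t\,d_j$. Concerning the third vector: for real $\xi_1,\dots,\xi_6$ and $y_i=\xi_i+\rho$ let \[P_7(\zeta)=\zeta^3-\zeta^2\sum_i y_i+\zeta\sum_{i+1<j}y_iy_j-\sum_{i+1<j,\;j+1<k}y_iy_jy_k,\] so that $P_A(\lambda,\theta)=-\lambda P_7(\lambda^2)$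 with $\rho=\cos^2\theta$ if the $\xi_i$ come from $A$ as above. Then $\vec\xi_3$ solves the problem formally: with $p+X=\sqrt2$ and $p-X=-\sqrt{2-\sqrt2}$, for $\xi=\vec\xi_3$ one has, identically in $\rho$ and $\zeta$, \[P_7(\zeta)=\bigl(\zeta-(d_3^2+\rho(2+\sqrt2))\bigr)\Bigl(\zeta^2-2\zeta\bigl(c_3^2+\rho(p^2+X^2)\bigr)+\bigl(c_3^2+\rho(X^2-p^2)\bigr)^2\Bigr).\] (As the fifth entry of $\vec\xi_3$ is negative while all $\xi_j\ge0$, the cases $j=3,6$ do not occur for an actual matrix $A$.) -/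

import Mathlib

open scoped Matrix Topology

noncomputable section

/-- `A` is reciprocal with zero main diagonal: tridiagonal, `a_{ii} = 0`, and
`a_{i,i+1} a_{i+1,i} = 1`. -/
structure IsReciprocalZeroDiag {n : ℕ} (A : Matrix (Fin n) (Fin n) ℂ) : Prop where
  diag_eq_zero : ∀ i, A i i = 0
  tridiagonal : ∀ i j : Fin n, (i : ℕ) + 1 < j ∨ (j : ℕ) + 1 < i → A i j = 0
  mul_eq_one : ∀ i j : Fin n, (i : ℕ) + 1 = j → A i j * A j i = 1

/-- `Re M = (M + M*) / 2`. -/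
def matrixRe {n : ℕ} (M : Matrix (Fin n) (Fin n) ℂ) : Matrix (Fin n) (Fin n) ℂ :=
  (1 / 2 : ℂ) • (M + Mᴴ)

/-- The Kippenhahn polynomial `P_A(x, θ) = det (Re (e^{iθ} A) - x I)`. -/
def kippenhahnPoly {n : ℕ} (A : Matrix (Fin n) (Fin n) ℂ) (x θ : ℝ) : ℂ :=
  (matrixRe (Complex.exp (θ * Complex.I) • A) - (x : ℂ) • (1 : Matrix (Fin n) (Fin n) ℂ)).det

/-- The Kippenhahn curve `C(A)`: the envelope of the family of lines `e^{-iθ} (l(θ) + i ℝ)`, where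
`l(θ)` runs through the roots of `P_A(·, θ)`. Locally these roots are given by real analytic
branches `l`. The line with parameter `θ` is `F(z, θ) := Re (e^{iθ} z) - l(θ) = 0`; together with
`∂F/∂θ = 0` this gives the point `z = e^{-iθ} (l(θ) - i l'(θ))` of the envelope. -/
def kippenhahnCurve {n : ℕ} (A : Matrix (Fin n) (Fin n) ℂ) : Set ℂ :=
  {z | ∃ (θ : ℝ) (l : ℝ → ℝ), AnalyticAt ℝ l θ ∧
    (∀ᶠ s in 𝓝 θ, kippenhahnPoly A (l s) s = 0) ∧
    z = Complex.exp (-(θ * Complex.I)) * ((l θ : ℂ) - Complex.I * ((deriv l θ : ℝ) : ℂ))}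

/-- The ellipse with foci `f`, `g` and minor half-axis `c` (used for `c > 0`): the sum of the
distances to the foci is the major axis `2 √(c² + (|f - g| / 2)²)`. -/
def ellipse (f g : ℂ) (c : ℝ) : Set ℂ :=
  {z | dist z f + dist z g = 2 * Real.sqrt (c ^ 2 + (dist f g / 2) ^ 2)}

/-- `S` contains a (nondegenerate) ellipse with foci `f` and `g`. -/
def ContainsEllipse (S : Set ℂ) (f g : ℂ) : Prop :=
  ∃ c : ℝ, 0 < c ∧ ellipse f g c ⊆ S

/-- `ξ_j = (|a_{j,j+1}| - |a_{j+1,j}|)² / 4`, for `j = 1, …, n - 1` (indexed from `0`). -/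
def xi {n : ℕ} (A : Matrix (Fin (n + 1)) (Fin (n + 1)) ℂ) (j : Fin n) : ℝ :=
  (‖A j.castSucc j.succ‖ - ‖A j.succ j.castSucc‖) ^ 2 / 4

/-- The cubic `P₇(ζ)` attached to a real `6`-tuple `ξ` and `ρ`: with `y_i = ξ_i + ρ`, it is
`ζ³ - ζ² ∑ y_i + ζ ∑ y_i y_j - ∑ y_i y_j y_k`, the sums over increasing, pairwise nonconsecutive
indices. For a reciprocal `7 × 7` matrix `A` with zero diagonal and `ξ = xi A` it satisfies
`P_A(x, θ) = - x P₇(x²)` with `ρ = cos² θ`. -/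
def polyP7 (ξ : Fin 6 → ℝ) (ρ ζ : ℝ) : ℝ :=
  ζ ^ 3 - ζ ^ 2 * (∑ i : Fin 6, (ξ i + ρ))
    + ζ * (∑ i : Fin 6, ∑ j : Fin 6,
        if (i : ℕ) + 1 < j then (ξ i + ρ) * (ξ j + ρ) else 0)
    - ∑ i : Fin 6, ∑ j : Fin 6, ∑ k : Fin 6,
        if (i : ℕ) + 1 < j ∧ (j : ℕ) + 1 < k then (ξ i + ρ) * (ξ j + ρ) * (ξ k + ρ) else 0

def xiVec1 : Fin 6 → ℝ :=
  ![1, 0,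
    7 * √2 - 4 * √(7 * √2 + 10) + 9,
    -2 * (√2 + 2 * √(4 - 2 * √2) - 4),
    8 * √2 - 6 * √(2 * (√2 + 2)) + 5,
    2 * (-2 * √2 + √(14 * √2 + 20) - 3)]

def xiVec2 : Fin 6 → ℝ :=
  ![1, 0,
    2 * √(2 - √2) - 3 / √2 + 2,
    2 * √(√2 + 2) - 1 / √2 - 2,
    -2 * (√2 + 2 * √(4 - 2 * √2) - 4),
    6 * √2 + 4 * √(10 - 7 * √2) - 9]

/-- The normalizing constant of `xiVec3` (approximately `0.690718`). -/
def xi3Scale : ℝ := (2 + 2 * √2) * √(4 - 2 * √2) - 1 - 5 * √2 / 2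

/-- The closed form of the vector `≈ (1, 0.447769, 0, 1.21903, -0.161745, 2.4715)`. -/
def xiVec3 : Fin 6 → ℝ :=
  xi3Scale⁻¹ • ![xi3Scale, 1 - xi3Scale, 0,
    8 - 2 * √2 - 4 * √(4 - 2 * √2),
    7 * √2 / 2 - 2 - 2 * √2 * √(4 - 2 * √2),
    1 + √2 / 2]

/-- The three vectors, followed by their reversals under `ξ_j ↔ ξ_{7-j}`. -/
def xiVec : Fin 6 → Fin 6 → ℝ :=
  ![xiVec1, xiVec2, xiVec3,
    fun i => xiVec1 i.rev, fun i => xiVec2 i.rev, fun i => xiVec3 i.rev]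

/-- Six-digit decimal values of the first three vectors. -/
def xiVecApprox : Fin 3 → Fin 6 → ℝ :=
  ![![1, 0, 1.05595, 0.842004, 0.634953, 0.960434],
    ![1, 0, 1.40941, 0.988411, 0.842004, 0.753383],
    ![1, 0.447769, 0, 1.21903, -0.161745, 2.4715]]

/-- Minor half-axis of `± E` for the vector `xiVec3`. -/
def halfE3 : ℝ := √(xi3Scale⁻¹)

/-- Minor half-axis of `E₀` for the vector `xiVec3`. -/
def halfE03 : ℝ := √(xi3Scale⁻¹ * (6 + 2 * √2 - (4 + 2 * √2) * √(4 - 2 * √2)))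

/-- Minor half-axes of `± E` for the six vectors (at `t = 1`). -/
def halfE : Fin 6 → ℝ := ![1, 1, halfE3, 1, 1, halfE3]

/-- Minor half-axes of `E₀` for the six vectors (at `t = 1`). -/
def halfE0 : Fin 6 → ℝ :=
  ![√(9 * √2 - 4 * √(14 * √2 + 20) + 15), √(2 * (√2 + √(4 - 2 * √2) - 1)), halfE03,
    √(9 * √2 - 4 * √(14 * √2 + 20) + 15), √(2 * (√2 + √(4 - 2 * √2) - 1)), halfE03]

end

/-! ### The cubic attached to a path, and its formal solutions -/

/-! The Kippenhahn polynomial of a reciprocal `7 × 7` matrix is `-x P₇(x²)` with `ρ = cos² θ`, so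
only the six numbers `ξ_j` matter. The tangent lines of an ellipse with foci `m ± X` and minor
half-axis `c` are `l = m cos θ ± √(c² + X² cos² θ)`. Together with its mirror image `-E`, such an
ellipse contributes to `P₇` the quadratic factor `ζ² - 2ζ(c² + ρ(m² + X²)) + (c² + ρ(X² - m²))²`.
For the foci in question `m² + X² = 2 - √2/2` and `X² - m² = rootB`, and the cofactor must be `ζ -
(D + ρ(2 + √2))`. This identity in `ρ` and `ζ` is `SplitsAs ξ c² D`.

From curve to identity: an ellipse inside the curve is uncountable, while the curve is covered by
countably many analytic arcs, so one arc meets the ellipse uncountably often and by the identity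
theorem consists of its tangents (`exists_arc_of_subset_kippenhahnCurve`,
`sq_eq_of_envelope_meets_ellipse`). Division with remainder then forces the splitting
(`splitsAs_of_tangent`). Conversely, a splitting with `D > 0` gives all roots explicitly, hence the
whole curve (`kippenhahnCurve_eq_of_splitsAs`).

Solving the identity: at `ρ = 0` the cubic belongs to a path with edge weights `√ξ_j` and has the
double root `C = c²`. A Jacobi matrix with nonzero weights has simple spectrum, so some `ξ_j`
vanishes and `C` is the root of an end piece (`path_decomposes`). Up to reversal and scaling to `C =
1` there are two cases. If `ξ_1 = 1`, `ξ_2 = 0`, elimination leaves a quadratic for `D` whose roots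
give the first two vectors. If `ξ_3 = 0`, `ξ_1 + ξ_2 = 1`, it leaves another quadratic, each of
whose roots makes some `ξ_j` negative; one of them is the third vector. -/

theorem polyP7_eq (ξ : Fin 6 → ℝ) (ρ ζ : ℝ) :
    polyP7 ξ ρ ζ = ζ ^ 3 - ζ ^ 2 * (ξ 0 + ξ 1 + ξ 2 + ξ 3 + ξ 4 + ξ 5 + 6 * ρ)
      + ζ * ((ξ 0 + ρ) * (ξ 2 + ρ) + (ξ 0 + ρ) * (ξ 3 + ρ) + (ξ 0 + ρ) * (ξ 4 + ρ)
        + (ξ 0 + ρ) * (ξ 5 + ρ) + (ξ 1 + ρ) * (ξ 3 + ρ) + (ξ 1 + ρ) * (ξ 4 + ρ)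
        + (ξ 1 + ρ) * (ξ 5 + ρ) + (ξ 2 + ρ) * (ξ 4 + ρ) + (ξ 2 + ρ) * (ξ 5 + ρ)
        + (ξ 3 + ρ) * (ξ 5 + ρ))
      - ((ξ 0 + ρ) * (ξ 2 + ρ) * (ξ 4 + ρ) + (ξ 0 + ρ) * (ξ 2 + ρ) * (ξ 5 + ρ)
        + (ξ 0 + ρ) * (ξ 3 + ρ) * (ξ 5 + ρ) + (ξ 1 + ρ) * (ξ 3 + ρ) * (ξ 5 + ρ)) := by
  simp only [polyP7, Fin.sum_univ_six]
  simp
  ring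

theorem polyP7_rev (ξ : Fin 6 → ℝ) (ρ ζ : ℝ) :
    polyP7 (fun i => ξ i.rev) ρ ζ = polyP7 ξ ρ ζ := by
  have h0 : (0 : Fin 6).rev = 5 := rfl
  have h1 : (1 : Fin 6).rev = 4 := rfl
  have h2 : (2 : Fin 6).rev = 3 := rfl
  have h3 : (3 : Fin 6).rev = 2 := rfl
  have h4 : (4 : Fin 6).rev = 1 := rfl
  have h5 : (5 : Fin 6).rev = 0 := rfl
  simp only [polyP7_eq, h0, h1, h2, h3, h4, h5]
  ring

/-- Homogeneity, which allows the normalization `C = 1`. -/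
theorem polyP7_smul (t : ℝ) (ξ : Fin 6 → ℝ) (ρ ζ : ℝ) :
    polyP7 (t • ξ) (t * ρ) (t * ζ) = t ^ 3 * polyP7 ξ ρ ζ := by
  simp only [polyP7_eq, Pi.smul_apply, smul_eq_mul]
  ring

/-! ### Radicals in the field generated by `√2` and `√(4 - 2√2)` -/

/-- The number `√(4 - 2√2)`; together with `√2` it generates all radicals that occur. -/
noncomputable def rootB : ℝ := √(4 - 2 * √2)

theorem sq_sqrt_two : √2 ^ 2 = (2 : ℝ) := Real.sq_sqrt (by norm_num)

theorem sqrt_two_bounds : (1.41421356237 : ℝ) < √2 ∧ √2 < (1.41421356238 : ℝ) := by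
  constructor
  · exact Real.lt_sqrt_of_sq_lt (by norm_num)
  · exact (Real.sqrt_lt' (by norm_num)).2 (by norm_num)

theorem sq_rootB : rootB ^ 2 = 4 - 2 * √2 :=
  Real.sq_sqrt (by linarith [sqrt_two_bounds.2])

theorem rootB_bounds : (1.08239220028 : ℝ) < rootB ∧ rootB < (1.0823922003 : ℝ) := by
  have h := sqrt_two_bounds
  constructor
  · exact Real.lt_sqrt_of_sq_lt (by norm_num; linarith)
  · exact (Real.sqrt_lt' (by norm_num)).2 (by norm_num; linarith)

/-- Every number that occurs is written as a rational combination of `1`, `√2`, `rootB`, `√2 *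
rootB`. With bounds for these three irrationals as atoms, numerical estimates become linear
arithmetic. -/
theorem sqrt_two_mul_rootB_bounds :
    (1.5307337294 : ℝ) < √2 * rootB ∧ √2 * rootB < (1.5307337295 : ℝ) := by
  have h := sqrt_two_bounds
  have h' := rootB_bounds
  constructor <;> nlinarith

theorem sqrt_two_sub_sqrt_two : √(2 - √2) = √2 * rootB / 2 := by
  have h := sqrt_two_mul_rootB_bounds
  rw [Real.sqrt_eq_iff_mul_self_eq_of_pos (by linarith)]
  linear_combination (rootB ^ 2 / 4) * sq_sqrt_two + (1 / 2) * sq_rootB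

theorem sqrt_two_add_sqrt_two : √(2 + √2) = rootB + √2 * rootB / 2 := by
  have h := sqrt_two_mul_rootB_bounds
  have h' := rootB_bounds
  rw [Real.sqrt_eq_iff_mul_self_eq_of_pos (by linarith)]
  linear_combination (rootB ^ 2 / 4 - 2) * sq_sqrt_two + (3 / 2 + √2) * sq_rootB

theorem sqrt_seven_mul_sqrt_two_add_ten :
    √(7 * √2 + 10) = 2 * rootB + 3 / 2 * (√2 * rootB) := by
  have h := sqrt_two_mul_rootB_bounds
  have h' := rootB_bounds
  rw [Real.sqrt_eq_iff_mul_self_eq_of_pos (by linarith)]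
  linear_combination (9 / 4 * rootB ^ 2 - 12) * sq_sqrt_two + (17 / 2 + 6 * √2) * sq_rootB

theorem sqrt_two_mul_sqrt_two_add_two : √(2 * (√2 + 2)) = rootB + √2 * rootB := by
  have h := sqrt_two_mul_rootB_bounds
  have h' := rootB_bounds
  rw [Real.sqrt_eq_iff_mul_self_eq_of_pos (by linarith)]
  linear_combination (rootB ^ 2 - 4) * sq_sqrt_two + (3 + 2 * √2) * sq_rootB

theorem sqrt_fourteen_mul_sqrt_two_add_twenty :
    √(14 * √2 + 20) = 3 * rootB + 2 * (√2 * rootB) := by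
  have h := sqrt_two_mul_rootB_bounds
  have h' := rootB_bounds
  rw [Real.sqrt_eq_iff_mul_self_eq_of_pos (by linarith)]
  linear_combination (4 * rootB ^ 2 - 24) * sq_sqrt_two + (17 + 12 * √2) * sq_rootB

theorem sqrt_ten_sub_seven_mul_sqrt_two :
    √(10 - 7 * √2) = rootB - √2 * rootB / 2 := by
  have h := sqrt_two_mul_rootB_bounds
  have h' := rootB_bounds
  rw [Real.sqrt_eq_iff_mul_self_eq_of_pos (by linarith)]
  linear_combination (rootB ^ 2 / 4 + 2) * sq_sqrt_two + (3 / 2 - √2) * sq_rootB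

theorem inv_sqrt_two : (√2)⁻¹ = √2 / 2 := by
  have h := sqrt_two_bounds.1
  have : √2 ≠ 0 := by linarith
  field_simp
  exact sq_sqrt_two.symm

theorem xiVec1_eq : xiVec1 = ![1, 0, 9 + 7 * √2 - 8 * rootB - 6 * (√2 * rootB),
    8 - 2 * √2 - 4 * rootB, 5 + 8 * √2 - 6 * rootB - 6 * (√2 * rootB),
    -6 - 4 * √2 + 6 * rootB + 4 * (√2 * rootB)] := by
  rw [xiVec1, sqrt_seven_mul_sqrt_two_add_ten, sqrt_two_mul_sqrt_two_add_two,
    sqrt_fourteen_mul_sqrt_two_add_twenty, ← rootB]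
  funext i
  fin_cases i <;> simp <;> ring

theorem xiVec2_eq : xiVec2 = ![1, 0, 2 - 3 / 2 * √2 + √2 * rootB,
    -2 - √2 / 2 + 2 * rootB + √2 * rootB, 8 - 2 * √2 - 4 * rootB,
    -9 + 6 * √2 + 4 * rootB - 2 * (√2 * rootB)] := by
  rw [xiVec2, sqrt_two_sub_sqrt_two, sqrt_ten_sub_seven_mul_sqrt_two, add_comm √2 2,
    sqrt_two_add_sqrt_two, ← rootB, div_eq_mul_inv 3, div_eq_mul_inv 1, inv_sqrt_two]
  funext i
  fin_cases i <;> simp <;> ring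

theorem xi3Scale_eq : xi3Scale = 2 * rootB + 2 * (√2 * rootB) - 1 - 5 * √2 / 2 := by
  rw [xi3Scale, ← rootB]; ring

theorem xi3Scale_bounds : (0.690717 : ℝ) < xi3Scale ∧ xi3Scale < (0.690719 : ℝ) := by
  have h := sqrt_two_bounds
  have h' := rootB_bounds
  have h'' := sqrt_two_mul_rootB_bounds
  rw [xi3Scale_eq]
  constructor <;> linarith

theorem xiVec3_eq : xiVec3 = xi3Scale⁻¹ • ![xi3Scale, 1 - xi3Scale, 0,
    8 - 2 * √2 - 4 * rootB, 7 * √2 / 2 - 2 - 2 * (√2 * rootB), 1 + √2 / 2] := by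
  rw [xiVec3, ← rootB]
  simp only [mul_assoc]

theorem sq_halfE3 : halfE3 ^ 2 = xi3Scale⁻¹ :=
  Real.sq_sqrt (inv_nonneg.2 (by linarith [xi3Scale_bounds.1]))

theorem halfE03_eq :
    halfE03 = √(xi3Scale⁻¹ * (6 + 2 * √2 - 4 * rootB - 2 * (√2 * rootB))) := by
  rw [halfE03, ← rootB]
  congr 2
  ring

theorem sq_halfE03 :
    halfE03 ^ 2 = xi3Scale⁻¹ * (6 + 2 * √2 - 4 * rootB - 2 * (√2 * rootB)) := by
  have h := sqrt_two_bounds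
  have h' := rootB_bounds
  have h'' := sqrt_two_mul_rootB_bounds
  rw [halfE03_eq]
  exact Real.sq_sqrt (mul_nonneg (inv_nonneg.2 (by linarith [xi3Scale_bounds.1])) (by linarith))

theorem xiVec_approx (j : Fin 3) (i : Fin 6) :
    |xiVec (j.castLE (by norm_num)) i - xiVecApprox j i| ≤ 5 / 10 ^ 6 := by
  have h := sqrt_two_bounds
  have h' := rootB_bounds
  have h'' := sqrt_two_mul_rootB_bounds
  have hu := xi3Scale_bounds
  have hu0 : (0 : ℝ) < xi3Scale := by linarith
  have key : ∀ a d : ℝ, |a - d * xi3Scale| ≤ 5 / 10 ^ 6 * xi3Scale →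
      |xi3Scale⁻¹ * a - d| ≤ 5 / 10 ^ 6 := by
    intro a d had
    have : xi3Scale⁻¹ * a - d = (a - d * xi3Scale) / xi3Scale := by field_simp
    rw [this, abs_div, abs_of_pos hu0, div_le_iff₀ hu0]
    exact had
  fin_cases j
  · change |xiVec1 i - _| ≤ _
    rw [xiVec1_eq, abs_le]
    fin_cases i <;> simp [xiVecApprox] <;>
      first | (norm_num; done) | (constructor <;> linarith)
  · change |xiVec2 i - _| ≤ _
    rw [xiVec2_eq, abs_le]
    fin_cases i <;> simp [xiVecApprox] <;>
      first | (norm_num; done) | (constructor <;> linarith)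
  · change |xiVec3 i - _| ≤ _
    rw [xiVec3_eq]
    refine key _ _ ?_
    rw [abs_le, xi3Scale_eq]
    fin_cases i <;> simp [xiVecApprox] <;>
      first | (norm_num; done) | (constructor <;> linarith) | linarith

theorem halfE3_approx : |halfE3 - 1.20323| ≤ 5 / 10 ^ 6 := by
  have hu := xi3Scale_bounds
  have hu0 : (0 : ℝ) < xi3Scale := by linarith
  have h1 : (1.203225 : ℝ) ≤ halfE3 := by
    refine Real.le_sqrt_of_sq_le ?_
    rw [← one_div, le_div_iff₀ hu0]
    nlinarith
  have h2 : halfE3 ≤ 1.203235 := by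
    refine (Real.sqrt_le_left (by norm_num)).2 ?_
    rw [← one_div, div_le_iff₀ hu0]
    nlinarith
  rw [abs_le]
  constructor <;> linarith

theorem halfE03_approx : |halfE03 - 1.44257| ≤ 5 / 10 ^ 6 := by
  have h := sqrt_two_bounds
  have h' := rootB_bounds
  have h'' := sqrt_two_mul_rootB_bounds
  have hu := xi3Scale_bounds
  have hu0 : (0 : ℝ) < xi3Scale := by linarith
  rw [halfE03_eq, mul_comm, ← div_eq_mul_inv]
  rw [xi3Scale_eq] at hu0 ⊢
  have h1 : (1.442565 : ℝ) ≤ √((6 + 2 * √2 - 4 * rootB - 2 * (√2 * rootB)) /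
      (2 * rootB + 2 * (√2 * rootB) - 1 - 5 * √2 / 2)) := by
    refine Real.le_sqrt_of_sq_le ?_
    rw [le_div_iff₀ hu0]
    linarith
  have h2 : √((6 + 2 * √2 - 4 * rootB - 2 * (√2 * rootB)) /
      (2 * rootB + 2 * (√2 * rootB) - 1 - 5 * √2 / 2)) ≤ (1.442575 : ℝ) := by
    refine (Real.sqrt_le_left (by norm_num)).2 ?_
    rw [div_le_iff₀ hu0]
    linarith
  rw [abs_le]
  constructor <;> linarith

/-! ### Splitting of the cubic as a system of six equations -/

/-- Formal splitting of the cubic into the factor of the ellipse centered at `0` and the quadratic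
factor of a pair of opposite ellipses. -/
def SplitsAs (ξ : Fin 6 → ℝ) (C D : ℝ) : Prop :=
  ∀ ρ ζ : ℝ, polyP7 ξ ρ ζ = (ζ - (D + ρ * (2 + √2))) *
    (ζ ^ 2 - 2 * ζ * (C + ρ * (2 - √2 / 2)) + (C + ρ * rootB) ^ 2)

theorem SplitsAs.rev {ξ : Fin 6 → ℝ} {C D : ℝ} (h : SplitsAs ξ C D) :
    SplitsAs (fun i => ξ i.rev) C D := fun ρ ζ => by rw [polyP7_rev, h]

theorem SplitsAs.smul {ξ : Fin 6 → ℝ} {C D t : ℝ} (ht : t ≠ 0) (h : SplitsAs ξ C D) :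
    SplitsAs (t • ξ) (t * C) (t * D) := fun ρ ζ => by
  have e := polyP7_smul t ξ (t⁻¹ * ρ) (t⁻¹ * ζ)
  rw [mul_inv_cancel_left₀ ht, mul_inv_cancel_left₀ ht] at e
  rw [e, h]
  field_simp

/-- Comparison of coefficients; the second and third equations come from `ζρ` and `ρ²`, simplified
by the earlier ones. The terms free of `ξ`, `C`, `D` agree automatically: at `ξ = 0`, `ρ = 1` the
roots of the cubic are `4 cos²(kπ/8)`, that is `2 + √2`, `2`, `2 - √2`, the squares of the
prescribed foci. -/
theorem splitsAs_of_coeff {ξ : Fin 6 → ℝ} {C D : ℝ}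
    (h1 : ξ 0 + ξ 1 + ξ 2 + ξ 3 + ξ 4 + ξ 5 = 2 * C + D)
    (h2 : ξ 0 + ξ 5 = 2 * C * (rootB + 2 * √2 - 2) + (1 - √2) * (2 * C + D))
    (h3 : ξ 2 + ξ 3 = 2 * C + D - 4 * √2 * C + 2 * √2 * rootB * C)
    (h4 : ξ 0 * ξ 2 + ξ 0 * ξ 3 + ξ 0 * ξ 4 + ξ 0 * ξ 5 + ξ 1 * ξ 3 + ξ 1 * ξ 4 + ξ 1 * ξ 5
      + ξ 2 * ξ 4 + ξ 2 * ξ 5 + ξ 3 * ξ 5 = C ^ 2 + 2 * C * D)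
    (h5 : 2 * (ξ 0 * ξ 2) + ξ 0 * ξ 4 + ξ 2 * ξ 4 + 2 * (ξ 0 * ξ 5) + ξ 2 * ξ 5 + ξ 0 * ξ 3
      + 2 * (ξ 3 * ξ 5) + ξ 1 * ξ 3 + ξ 1 * ξ 5 = (2 + √2) * C ^ 2 + 2 * C * D * rootB)
    (h6 : ξ 0 * ξ 2 * ξ 4 + ξ 0 * ξ 2 * ξ 5 + ξ 0 * ξ 3 * ξ 5 + ξ 1 * ξ 3 * ξ 5 = D * C ^ 2) :
    SplitsAs ξ C D := by
  intro ρ ζ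
  rw [polyP7_eq]
  have hS := sq_sqrt_two
  have hB := sq_rootB
  linear_combination (-ζ ^ 2 + 3 * ζ * ρ - ρ ^ 2) * h1 + (ζ * ρ - 2 * ρ ^ 2) * h2 - ρ ^ 2 * h3
    + ζ * h4 - ρ * h5 - h6 + (ζ * ρ ^ 2 - 2 * ρ ^ 3) * hS
    + (-ζ * ρ ^ 2 + D * ρ ^ 2 + (2 + √2) * ρ ^ 3) * hB

theorem SplitsAs.coeff {ξ : Fin 6 → ℝ} {C D : ℝ} (h : SplitsAs ξ C D) :
    ξ 0 + ξ 1 + ξ 2 + ξ 3 + ξ 4 + ξ 5 = 2 * C + D ∧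
    ξ 0 + ξ 5 = 2 * C * (rootB + 2 * √2 - 2) + (1 - √2) * (2 * C + D) ∧
    ξ 2 + ξ 3 = 2 * C + D - 4 * √2 * C + 2 * √2 * rootB * C ∧
    ξ 0 * ξ 2 + ξ 0 * ξ 3 + ξ 0 * ξ 4 + ξ 0 * ξ 5 + ξ 1 * ξ 3 + ξ 1 * ξ 4 + ξ 1 * ξ 5
      + ξ 2 * ξ 4 + ξ 2 * ξ 5 + ξ 3 * ξ 5 = C ^ 2 + 2 * C * D ∧
    2 * (ξ 0 * ξ 2) + ξ 0 * ξ 4 + ξ 2 * ξ 4 + 2 * (ξ 0 * ξ 5) + ξ 2 * ξ 5 + ξ 0 * ξ 3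
      + 2 * (ξ 3 * ξ 5) + ξ 1 * ξ 3 + ξ 1 * ξ 5 = (2 + √2) * C ^ 2 + 2 * C * D * rootB ∧
    ξ 0 * ξ 2 * ξ 4 + ξ 0 * ξ 2 * ξ 5 + ξ 0 * ξ 3 * ξ 5 + ξ 1 * ξ 3 * ξ 5 = D * C ^ 2 := by
  have f := fun ρ ζ => (polyP7_eq ξ ρ ζ).symm.trans (h ρ ζ)
  have hS := sq_sqrt_two
  have hB := sq_rootB
  -- Finite differences of the identity at `ρ, ζ ∈ {0, ±1}` isolate its coefficients.
  have f00 := f 0 0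
  have f01 := f 0 1
  have f0m := f 0 (-1)
  have f11 := f 1 1
  have f1m := f 1 (-1)
  have f10 := f 1 0
  have fm0 := f (-1) 0
  have h1 : ξ 0 + ξ 1 + ξ 2 + ξ 3 + ξ 4 + ξ 5 = 2 * C + D := by
    linear_combination -(f01 + f0m - 2 * f00) / 2
  have h2 : ξ 0 + ξ 5 = 2 * C * (rootB + 2 * √2 - 2) + (1 - √2) * (2 * C + D) := by
    linear_combination (f11 - f1m) / 2 - (f01 - f0m) / 2 - 3 * h1 - hS + hB
  refine ⟨h1, h2, ?_, ?_, ?_, ?_⟩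
  · linear_combination -(f10 + fm0 - 2 * f00) / 2 - h1 - 2 * h2 + D * hB
  · linear_combination (f01 - f0m) / 2
  · linear_combination -(f10 - fm0) / 2 + (2 + √2) * hB - 2 * hS
  · linear_combination -f00

theorem splitsAs_xiVec1 : SplitsAs xiVec1 1 (15 + 9 * √2 - 12 * rootB - 8 * (√2 * rootB)) := by
  have hS := sq_sqrt_two
  have hB := sq_rootB
  rw [xiVec1_eq]
  apply splitsAs_of_coeff <;> simp <;> grind

theorem splitsAs_xiVec2 : SplitsAs xiVec2 1 (-2 + 2 * √2 + 2 * rootB) := by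
  have hS := sq_sqrt_two
  have hB := sq_rootB
  rw [xiVec2_eq]
  apply splitsAs_of_coeff <;> simp <;> grind

theorem splitsAs_xiVec3 : SplitsAs xiVec3 (halfE3 ^ 2) (halfE03 ^ 2) := by
  have hS := sq_sqrt_two
  have hB := sq_rootB
  have hu0 : xi3Scale⁻¹ ≠ 0 := inv_ne_zero (by linarith [xi3Scale_bounds.1])
  rw [xiVec3_eq, sq_halfE3, sq_halfE03]
  -- Scaling to `C = 1` removes the inverse of `xi3Scale`, so that the equations become polynomial
  -- in `√2` and `rootB`.
  conv => arg 2; rw [← mul_one xi3Scale⁻¹]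
  refine SplitsAs.smul hu0 ?_
  rw [xi3Scale_eq]
  apply splitsAs_of_coeff <;> simp <;> grind

/-! ### Decoupling at a double root, and the nonnegative solutions -/

/-- A tridiagonal matrix with nonnegative off-diagonal data and a double eigenvalue decomposes:
here for paths with seven vertices and a positive root of the cubic of multiplicity two. -/
theorem path_decomposes {x₁ x₂ x₃ x₄ x₅ x₆ C : ℝ} (h₁ : 0 ≤ x₁) (h₂ : 0 ≤ x₂) (h₃ : 0 ≤ x₃)
    (h₄ : 0 ≤ x₄) (h₅ : 0 ≤ x₅) (h₆ : 0 ≤ x₆) (hC : 0 < C)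
    (hf : C ^ 3 - C ^ 2 * (x₁ + x₂ + x₃ + x₄ + x₅ + x₆)
      + C * (x₁ * x₃ + x₁ * x₄ + x₁ * x₅ + x₁ * x₆ + x₂ * x₄ + x₂ * x₅ + x₂ * x₆ + x₃ * x₅
        + x₃ * x₆ + x₄ * x₆)
      - (x₁ * x₃ * x₅ + x₁ * x₃ * x₆ + x₁ * x₄ * x₆ + x₂ * x₄ * x₆) = 0)
    (hf' : 3 * C ^ 2 - 2 * C * (x₁ + x₂ + x₃ + x₄ + x₅ + x₆)
      + (x₁ * x₃ + x₁ * x₄ + x₁ * x₅ + x₁ * x₆ + x₂ * x₄ + x₂ * x₅ + x₂ * x₆ + x₃ * x₅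
        + x₃ * x₆ + x₄ * x₆) = 0) :
    (x₂ = 0 ∧ x₁ = C) ∨ (x₃ = 0 ∧ x₁ + x₂ = C) ∨ (x₄ = 0 ∧ x₅ + x₆ = C) ∨ (x₅ = 0 ∧ x₆ = C) := by
  have hC0 : C ≠ 0 := hC.ne'
  -- Characteristic polynomials `Q_k` of the initial subpaths with `k` vertices, evaluated at `√C`;
  -- for odd `k` the factor `√C` is removed.
  obtain ⟨p₂, hp₂⟩ : ∃ p, p = C - x₁ := ⟨_, rfl⟩
  obtain ⟨p₃, hp₃⟩ : ∃ p, p = p₂ - x₂ := ⟨_, rfl⟩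
  obtain ⟨p₄, hp₄⟩ : ∃ p, p = C * p₃ - x₃ * p₂ := ⟨_, rfl⟩
  obtain ⟨p₅, hp₅⟩ : ∃ p, p = p₄ - x₄ * p₃ := ⟨_, rfl⟩
  obtain ⟨p₆, hp₆⟩ : ∃ p, p = C * p₅ - x₅ * p₄ := ⟨_, rfl⟩
  have hp₇ : p₆ = x₆ * p₅ := by
    simp only [hp₆, hp₅, hp₄, hp₃, hp₂]; linear_combination hf
  -- Christoffel-Darboux
  have cd : p₆ ^ 2 + C * x₆ * p₅ ^ 2 + x₆ * x₅ * p₄ ^ 2 + C * (x₆ * x₅ * x₄) * p₃ ^ 2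
      + x₆ * x₅ * x₄ * x₃ * p₂ ^ 2 + C * (x₆ * x₅ * x₄ * x₃ * x₂)
      + x₆ * x₅ * x₄ * x₃ * x₂ * x₁ = 0 := by
    have q₆ : p₆ = C ^ 3 - C ^ 2 * (x₁ + x₂ + x₃ + x₄ + x₅) + C * (x₁ * x₃ + x₁ * x₄ + x₁ * x₅
        + x₂ * x₄ + x₂ * x₅ + x₃ * x₅) - x₁ * x₃ * x₅ := by simp only [hp₆, hp₅, hp₄, hp₃, hp₂]; ring
    have : p₆ ^ 2 + C * x₆ * p₅ ^ 2 + x₆ * x₅ * p₄ ^ 2 + C * (x₆ * x₅ * x₄) * p₃ ^ 2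
      + x₆ * x₅ * x₄ * x₃ * p₂ ^ 2 + C * (x₆ * x₅ * x₄ * x₃ * x₂)
      + x₆ * x₅ * x₄ * x₃ * x₂ * x₁ = (p₆ - x₆ * p₅) * p₆ + 2 * C * p₆ *
      (3 * C ^ 2 - 2 * C * (x₁ + x₂ + x₃ + x₄ + x₅ + x₆)
      + (x₁ * x₃ + x₁ * x₄ + x₁ * x₅ + x₁ * x₆ + x₂ * x₄ + x₂ * x₅ + x₂ * x₆ + x₃ * x₅
        + x₃ * x₆ + x₄ * x₆)) - 2 * C * (p₆ - x₆ * p₅) * (3 * C ^ 2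
        - 2 * C * (x₁ + x₂ + x₃ + x₄ + x₅) + (x₁ * x₃ + x₁ * x₄ + x₁ * x₅
        + x₂ * x₄ + x₂ * x₅ + x₃ * x₅)) := by simp only [hp₆, hp₅, hp₄, hp₃, hp₂]; ring
    rw [this, hf', hp₇]; ring
  have n₁ : 0 ≤ C * x₆ * p₅ ^ 2 := by positivity
  have n₂ : 0 ≤ x₆ * x₅ * p₄ ^ 2 := by positivity
  have n₃ : 0 ≤ C * (x₆ * x₅ * x₄) * p₃ ^ 2 := by positivity
  have n₄ : 0 ≤ x₆ * x₅ * x₄ * x₃ * p₂ ^ 2 := by positivity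
  have n₅ : 0 ≤ C * (x₆ * x₅ * x₄ * x₃ * x₂) := by positivity
  have n₆ : 0 ≤ x₆ * x₅ * x₄ * x₃ * x₂ * x₁ := by positivity
  have e₆ : p₆ = 0 := by
    have : p₆ ^ 2 = 0 := le_antisymm (by linarith) (sq_nonneg _)
    exact pow_eq_zero_iff (two_ne_zero) |>.1 this
  have e₅ : p₅ = 0 := by
    -- If `x₆ = 0`, the last vertex is isolated and `C` is already a double root for the first six
    -- vertices, so the same sum-of-squares argument applies one step lower.
    by_cases z₆ : x₆ = 0
    · have cd' : C * p₅ ^ 2 + x₅ * p₄ ^ 2 + C * (x₅ * x₄) * p₃ ^ 2 + x₅ * x₄ * x₃ * p₂ ^ 2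
          + C * (x₅ * x₄ * x₃ * x₂) + x₅ * x₄ * x₃ * x₂ * x₁ = 0 := by
        have : C * p₅ ^ 2 + x₅ * p₄ ^ 2 + C * (x₅ * x₄) * p₃ ^ 2 + x₅ * x₄ * x₃ * p₂ ^ 2
          + C * (x₅ * x₄ * x₃ * x₂) + x₅ * x₄ * x₃ * x₂ * x₁ =
          2 * C * p₅ * (3 * C ^ 2 - 2 * C * (x₁ + x₂ + x₃ + x₄ + x₅) + (x₁ * x₃ + x₁ * x₄
            + x₁ * x₅ + x₂ * x₄ + x₂ * x₅ + x₃ * x₅))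
          - p₆ * (p₅ + 2 * C * (2 * C - (x₁ + x₂ + x₃ + x₄))) := by simp only [hp₆, hp₅, hp₄, hp₃, hp₂]; ring
        rw [this, e₆]
        rw [z₆] at hf'
        linear_combination 2 * C * p₅ * hf'
      have n₁ : 0 ≤ C * p₅ ^ 2 := by positivity
      have n₂ : 0 ≤ x₅ * p₄ ^ 2 := by positivity
      have n₃ : 0 ≤ C * (x₅ * x₄) * p₃ ^ 2 := by positivity
      have n₄ : 0 ≤ x₅ * x₄ * x₃ * p₂ ^ 2 := by positivity
      have n₅ : 0 ≤ C * (x₅ * x₄ * x₃ * x₂) := by positivity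
      have n₆ : 0 ≤ x₅ * x₄ * x₃ * x₂ * x₁ := by positivity
      have : C * p₅ ^ 2 = 0 := le_antisymm (by linarith) n₁
      simpa [hC0] using this
    · have : x₆ * p₅ = 0 := by rw [← hp₇, e₆]
      exact (mul_eq_zero.1 this).resolve_left z₆
  have t₅ : x₅ = 0 ∨ p₄ = 0 := mul_eq_zero.1 (by linear_combination C * e₅ + hp₆ - e₆)
  have t₄ : p₄ = 0 → x₄ = 0 ∨ p₃ = 0 := fun e => mul_eq_zero.1 (by linear_combination e - e₅ + hp₅)
  have t₃ : p₃ = 0 → (x₂ = 0 ∧ x₁ = C) ∨ (x₃ = 0 ∧ x₁ + x₂ = C) ∨ p₄ ≠ 0 := by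
    intro e
    by_cases e₄ : p₄ = 0
    · have : x₃ * p₂ = 0 := by linear_combination C * e - e₄ + hp₄
      rcases mul_eq_zero.1 this with z | z
      · exact Or.inr (Or.inl ⟨z, by linarith⟩)
      · exact Or.inl ⟨by linarith, by linarith⟩
    · exact Or.inr (Or.inr e₄)
  -- Two consecutive zeros `p₆ = p₅ = 0` propagate down the recursion until some `x_k` vanishes and
  -- cuts the path. Then either `C` is the root of the right piece, or it is a double root of the
  -- left piece, whose discriminant is a sum of nonnegative terms.
  by_cases e₄ : p₄ = 0
  · rcases t₄ e₄ with z₄ | e₃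
    · by_cases z : x₅ + x₆ = C
      · exact Or.inr (Or.inr (Or.inl ⟨z₄, z⟩))
      · have g : 2 * C - (x₁ + x₂ + x₃) = 0 := by
          have : (2 * C - (x₁ + x₂ + x₃)) * (C - (x₅ + x₆)) = 0 := by
            subst z₄
            have : C ^ 2 - C * (x₁ + x₂ + x₃) + x₁ * x₃ = 0 := by
              rw [← e₄, hp₄, hp₃, hp₂]; ring
            linear_combination hf' - this
          exact (mul_eq_zero.1 this).resolve_right fun h => z (by linarith)
        have d : (x₁ - x₃) ^ 2 + x₂ ^ 2 + 2 * x₂ * (x₁ + x₃) = 0 := by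
          have : C ^ 2 - C * (x₁ + x₂ + x₃) + x₁ * x₃ = 0 := by
              rw [← e₄, hp₄, hp₃, hp₂]; ring
          linear_combination (2 * C - (x₁ + x₂ + x₃)) * g - 4 * this
        have : 0 ≤ x₂ * (x₁ + x₃) := by positivity
        have z₂ : x₂ = 0 := pow_eq_zero_iff two_ne_zero |>.1
          (le_antisymm (by linarith [sq_nonneg (x₁ - x₃)]) (sq_nonneg _))
        subst z₂
        have : x₁ - x₃ = 0 := pow_eq_zero_iff two_ne_zero |>.1 (by linarith)
        exact Or.inl ⟨rfl, by linarith⟩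
    · rcases t₃ e₃ with h | h | h
      · exact Or.inl h
      · exact Or.inr (Or.inl h)
      · exact absurd e₄ h
  · have z₅ := t₅.resolve_right e₄
    by_cases z : x₆ = C
    · exact Or.inr (Or.inr (Or.inr ⟨z₅, z⟩))
    · have q : C ^ 2 - C * (x₁ + x₂ + x₃ + x₄) + (x₁ * x₃ + x₁ * x₄ + x₂ * x₄) = 0 := by
        rw [← e₅, hp₅, hp₄, hp₃, hp₂]; ring
      have g : 2 * C - (x₁ + x₂ + x₃ + x₄) = 0 := by
        have : (2 * C - (x₁ + x₂ + x₃ + x₄)) * (C - x₆) = 0 := by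
          subst z₅
          linear_combination hf' - q
        exact (mul_eq_zero.1 this).resolve_right fun h => z (by linarith)
      have d : (x₁ + x₂ - x₃ - x₄) ^ 2 + 4 * (x₂ * x₃) = 0 := by
        linear_combination (2 * C - (x₁ + x₂ + x₃ + x₄)) * g - 4 * q
      have n : 0 ≤ x₂ * x₃ := by positivity
      have w : x₁ + x₂ - x₃ - x₄ = 0 := pow_eq_zero_iff two_ne_zero |>.1
        (le_antisymm (by linarith) (sq_nonneg _))
      have : x₂ * x₃ = 0 := le_antisymm (by linarith [sq_nonneg (x₁ + x₂ - x₃ - x₄)]) n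
      rcases mul_eq_zero.1 this with y | y
      · exact Or.inl ⟨y, by linarith⟩
      · exact Or.inr (Or.inl ⟨y, by linarith⟩)

/-- Three equations express `ξ 5`, `ξ 4` and `ξ 2 + ξ 3` affinely in `D`; the other two are then
linear in `ξ 2`, and eliminating it leaves a quadratic for `D`. The sixth equation is redundant,
since at `ρ = 0` both sides have the root `ζ = 1`. -/
theorem SplitsAs.eq_of_second_eq_zero {ξ : Fin 6 → ℝ} {D : ℝ} (h : SplitsAs ξ 1 D)
    (h0 : ξ 0 = 1) (h1 : ξ 1 = 0) : ξ = xiVec1 ∨ ξ = xiVec2 := by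
  obtain ⟨e1, e2, e3, e4, e5, -⟩ := h.coeff
  have hS := sq_sqrt_two
  have hB := sq_rootB
  have bS := sqrt_two_bounds
  have bB := rootB_bounds
  have bSB := sqrt_two_mul_rootB_bounds
  rw [h0] at e1 e2 e4 e5
  rw [h1] at e1 e4 e5
  have v5 : ξ 5 = 2 * rootB + 2 * √2 - 3 + (1 - √2) * D := by linear_combination e2
  have v4 : ξ 4 = 2 + 2 * √2 - 2 * rootB - 2 * √2 * rootB + (√2 - 1) * D := by
    linear_combination e1 - e2 - e3
  have v3 : ξ 3 = 2 + D - 4 * √2 + 2 * √2 * rootB - ξ 2 := by linear_combination e3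
  rw [v3] at e4 e5
  have e4' : ξ 2 * ξ 4 = D - ξ 5 * (2 + D - 4 * √2 + 2 * √2 * rootB) := by
    linear_combination e4 - e1 + e3
  have e5' : ξ 2 * (1 - ξ 5) = 2 + √2 + 2 * D * rootB - (2 + D - 4 * √2 + 2 * √2 * rootB)
      - ξ 4 - 2 * ξ 5 - D - (2 + D - 4 * √2 + 2 * √2 * rootB) * ξ 5 := by
    linear_combination e5 - e4'
  -- The leading coefficient is about `-0.07`; the two roots are the values of `D` for `xiVec1` and
  -- `xiVec2`.
  have quad : (-16 + 11 * √2 + 6 * rootB - 4 * (√2 * rootB)) *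
      ((D - (15 + 9 * √2 - 12 * rootB - 8 * (√2 * rootB))) *
        (D - (-2 + 2 * √2 + 2 * rootB))) = 0 := by
    have : (D - ξ 5 * (2 + D - 4 * √2 + 2 * √2 * rootB)) * (1 - ξ 5) = ξ 4 *
        (2 + √2 + 2 * D * rootB - (2 + D - 4 * √2 + 2 * √2 * rootB)
      - ξ 4 - 2 * ξ 5 - D - (2 + D - 4 * √2 + 2 * √2 * rootB) * ξ 5) := by
      linear_combination ξ 4 * e5' - (1 - ξ 5) * e4'
    rw [v4, v5] at this
    clear e1 e2 e3 e4 e5 e4' e5' v3 v4 v5 h0 h1 bS bB bSB h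
    grind
  rcases mul_eq_zero.1 ((mul_eq_zero.1 quad).resolve_left (by linarith)) with hD | hD
  · left
    have hD : D = 15 + 9 * √2 - 12 * rootB - 8 * (√2 * rootB) := by linarith
    rw [hD] at v5 v4 v3 e4'
    have w5 : ξ 5 = -6 - 4 * √2 + 6 * rootB + 4 * (√2 * rootB) := by
      linear_combination v5 - 9 * hS + 8 * rootB * hS
    have w4 : ξ 4 = 5 + 8 * √2 - 6 * rootB - 6 * (√2 * rootB) := by
      linear_combination v4 + 9 * hS - 8 * rootB * hS
    have w2 : ξ 2 = 9 + 7 * √2 - 8 * rootB - 6 * (√2 * rootB) := by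
      have : ξ 4 ≠ 0 := by rw [w4]; linarith
      refine mul_right_cancel₀ this ?_
      rw [e4', w5, w4]
      clear w5 w4 e1 e2 e3 e4 e5 e4' e5' v3 v4 v5 h0 h1 bS bB bSB h
      grind
    have w3 : ξ 3 = 8 - 2 * √2 - 4 * rootB := by rw [v3, w2]; ring
    rw [xiVec1_eq]
    funext i
    fin_cases i <;> simp [h0, h1, w2, w3, w4, w5]
  · right
    have hD : D = -2 + 2 * √2 + 2 * rootB := by linarith
    rw [hD] at v5 v4 v3 e4'
    have w5 : ξ 5 = -9 + 6 * √2 + 4 * rootB - 2 * (√2 * rootB) := by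
      linear_combination v5 - 2 * hS
    have w4 : ξ 4 = 8 - 2 * √2 - 4 * rootB := by
      linear_combination v4 + 2 * hS
    have w2 : ξ 2 = 2 - 3 / 2 * √2 + √2 * rootB := by
      have : ξ 4 ≠ 0 := by rw [w4]; linarith
      refine mul_right_cancel₀ this ?_
      rw [e4', w5, w4]
      clear w5 w4 e1 e2 e3 e4 e5 e4' e5' v3 v4 v5 h0 h1 bS bB bSB h
      grind
    have w3 : ξ 3 = -2 - √2 / 2 + 2 * rootB + √2 * rootB := by rw [v3, w2]; ring
    rw [xiVec2_eq]
    funext i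
    fin_cases i <;> simp [h0, h1, w2, w3, w4, w5]

/-- With `ξ 2 = 0` the entries `ξ 0`, `ξ 3`, `ξ 5` are affine in `D`, and `ξ 3 * ξ 5 = D` is a
quadratic. Its first root gives a multiple of `xiVec3`, where `ξ 4 < 0`; the second gives `ξ 1 < 0`.
-/
theorem SplitsAs.third_ne_zero {ξ : Fin 6 → ℝ} {D : ℝ} (h : SplitsAs ξ 1 D)
    (hξ : ∀ i, 0 ≤ ξ i) (h1 : ξ 0 + ξ 1 = 1) : ξ 2 ≠ 0 := by
  intro h2
  obtain ⟨e1, e2, e3, e4, e5, e6⟩ := h.coeff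
  have hS := sq_sqrt_two
  have hB := sq_rootB
  have bS := sqrt_two_bounds
  have bB := rootB_bounds
  have bSB := sqrt_two_mul_rootB_bounds
  have p1 := hξ 1
  have p4 := hξ 4
  have w1 : ξ 1 = 1 - ξ 0 := by linarith
  have w3 : ξ 3 = 2 + D - 4 * √2 + 2 * √2 * rootB := by linear_combination e3 - h2
  rw [h2, w1] at e1 e4 e5 e6
  have e6' : ξ 3 * ξ 5 = D := by linear_combination e6
  have l1 : ξ 0 * (1 - (2 - 4 * √2 + 2 * √2 * rootB)) + ξ 5
      = 2 + √2 + 2 * D * rootB - 3 * D - (2 - 4 * √2 + 2 * √2 * rootB) := by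
    linear_combination e5 - ξ 0 * e1 - 2 * e6' - (1 - ξ 0) * w3
  have w0 : ξ 0 = 1 + √2 / 2 - √2 / 2 * D := by
    have : (-1 : ℝ) * (2 - 4 * √2 + 2 * √2 * rootB) ≠ 0 := by
      rw [mul_assoc]
      linarith
    refine mul_left_cancel₀ this ?_
    have : (-1 : ℝ) * (2 - 4 * √2 + 2 * √2 * rootB) * ξ 0 = 2 + √2 + 2 * D * rootB - 3 * D
      - (2 - 4 * √2 + 2 * √2 * rootB) - (2 * (rootB + 2 * √2 - 2) + (1 - √2) * (2 + D)) := by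
      linear_combination l1 - e2
    rw [this]
    clear l1 w3 e1 e2 e3 e4 e5 e6 e6' p1 p4 w1 h2 bS bB bSB h h1 this
    grind
  have w5 : ξ 5 = -3 + 3 / 2 * √2 + 2 * rootB + (1 - √2 / 2) * D := by
    linear_combination e2 - w0
  rw [w3, w5] at e6'
  have quad : (1 - √2 / 2) * ((D - (6 + 2 * √2 - 4 * rootB - 2 * (√2 * rootB))) *
      (D - (-3 + 3 * √2 - 2 * (√2 * rootB)))) = 0 := by
    clear l1 w0 w3 w5 e1 e2 e3 e4 e5 e6 p1 p4 w1 h2 bS bB bSB h h1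
    grind
  rcases mul_eq_zero.1 ((mul_eq_zero.1 quad).resolve_left (by linarith)) with hD | hD
  · have hD : D = 6 + 2 * √2 - 4 * rootB - 2 * (√2 * rootB) := by linarith
    have : ξ 4 = 1 + D - ξ 3 - ξ 5 := by linear_combination e1
    rw [w3, w5, hD] at this
    have : ξ 4 = 7 / 2 * √2 - 2 - 2 * (√2 * rootB) := by
      linear_combination this + hS - rootB * hS
    linarith
  · have hD : D = -3 + 3 * √2 - 2 * (√2 * rootB) := by linarith
    rw [w1, w0, hD] at p1
    have : 1 - (1 + √2 / 2 - √2 / 2 * (-3 + 3 * √2 - 2 * (√2 * rootB)))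
        = 3 - 2 * √2 - 2 * rootB := by
      linear_combination (3 / 2 - rootB) * hS
    linarith

/-- The nonnegative `6`-tuples whose cubic splits formally are multiples of `xiVec1`, `xiVec2` and
their reversals. -/
theorem SplitsAs.exists_eq_smul {ξ : Fin 6 → ℝ} {C D : ℝ} (h : SplitsAs ξ C D)
    (hξ : ∀ i, 0 ≤ ξ i) (hC : 0 < C) : ∃ j : Fin 6, ξ = C • xiVec j := by
  have hC0 : C ≠ 0 := hC.ne'
  have h' : SplitsAs (C⁻¹ • ξ) 1 (C⁻¹ * D) := by
    have := h.smul (inv_ne_zero hC0)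
    rwa [inv_mul_cancel₀ hC0] at this
  have hξ' : ∀ i, 0 ≤ (C⁻¹ • ξ) i := fun i => by
    simpa using mul_nonneg (inv_nonneg.2 hC.le) (hξ i)
  suffices H : ∀ η : Fin 6 → ℝ, (∀ i, 0 ≤ η i) → ∀ E, SplitsAs η 1 E → ∃ j : Fin 6, η = xiVec j by
    obtain ⟨j, hj⟩ := H _ hξ' _ h'
    exact ⟨j, by rw [← hj, smul_inv_smul₀ hC0]⟩
  clear! ξ C
  intro ξ hξ D h
  have hrev : (fun i => (fun i => ξ i.rev) i.rev) = ξ := by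
    funext i
    simp
  obtain ⟨e1, -, -, e4, -, e6⟩ := h.coeff
  rcases path_decomposes (hξ 0) (hξ 1) (hξ 2) (hξ 3) (hξ 4) (hξ 5) one_pos
    (by linear_combination -e1 + e4 - e6) (by linear_combination -2 * e1 + e4)
    with ⟨a, b⟩ | ⟨a, b⟩ | ⟨a, b⟩ | ⟨a, b⟩
  · rcases h.eq_of_second_eq_zero b a with e | e
    · exact ⟨0, e⟩
    · exact ⟨1, e⟩
  · exact absurd a (h.third_ne_zero hξ b)
  · exact absurd a (h.rev.third_ne_zero (fun i => hξ _) (by rw [add_comm]; exact b))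
  · rcases h.rev.eq_of_second_eq_zero b a with e | e
    · exact ⟨3, by rw [← hrev, e]; rfl⟩
    · exact ⟨4, by rw [← hrev, e]; rfl⟩

/-- The squares of the half-axes are determined by the cubic. -/
theorem SplitsAs.unique {ξ : Fin 6 → ℝ} {C C' D D' : ℝ} (h : SplitsAs ξ C D)
    (h' : SplitsAs ξ C' D') : C = C' := by
  obtain ⟨e1, e2, -⟩ := h.coeff
  obtain ⟨e1', e2', -⟩ := h'.coeff
  have bS := sqrt_two_bounds
  have bB := rootB_bounds
  have : 2 * (rootB + 2 * √2 - 2) ≠ 0 := by linarith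
  refine mul_left_cancel₀ this ?_
  linear_combination e2' - e2 + (1 - √2) * (e1 - e1')

theorem splitsAs_xiVec (j : Fin 6) : SplitsAs (xiVec j) (halfE j ^ 2) (halfE0 j ^ 2) := by
  have bS := sqrt_two_bounds
  have bB := rootB_bounds
  have bSB := sqrt_two_mul_rootB_bounds
  have a1 : √(9 * √2 - 4 * √(14 * √2 + 20) + 15) ^ 2
      = 15 + 9 * √2 - 12 * rootB - 8 * (√2 * rootB) := by
    rw [sqrt_fourteen_mul_sqrt_two_add_twenty, Real.sq_sqrt (by linarith)]
    ring
  have a2 : √(2 * (√2 + √(4 - 2 * √2) - 1)) ^ 2 = -2 + 2 * √2 + 2 * rootB := by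
    rw [← rootB, Real.sq_sqrt (by linarith)]
    ring
  have h1 : SplitsAs xiVec1 (1 ^ 2) (√(9 * √2 - 4 * √(14 * √2 + 20) + 15) ^ 2) := by
    rw [a1, one_pow]; exact splitsAs_xiVec1
  have h2 : SplitsAs xiVec2 (1 ^ 2) (√(2 * (√2 + √(4 - 2 * √2) - 1)) ^ 2) := by
    rw [a2, one_pow]; exact splitsAs_xiVec2
  fin_cases j
  exacts [h1, h2, splitsAs_xiVec3, h1.rev, h2.rev, splitsAs_xiVec3.rev]

theorem halfE0_pos (j : Fin 6) : 0 < halfE0 j := by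
  have bS := sqrt_two_bounds
  have bB := rootB_bounds
  have bSB := sqrt_two_mul_rootB_bounds
  have a1 : 0 < √(9 * √2 - 4 * √(14 * √2 + 20) + 15) := by
    rw [sqrt_fourteen_mul_sqrt_two_add_twenty]
    exact Real.sqrt_pos.2 (by linarith)
  have a2 : 0 < √(2 * (√2 + √(4 - 2 * √2) - 1)) := by
    rw [← rootB]
    exact Real.sqrt_pos.2 (by linarith)
  have a3 : 0 < halfE03 := by linarith [(abs_le.1 halfE03_approx).1]
  fin_cases j
  exacts [a1, a2, a3, a1, a2, a3]

theorem halfE_pos (j : Fin 6) : 0 < halfE j := by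
  have a3 : 0 < halfE3 := by linarith [(abs_le.1 halfE3_approx).1]
  fin_cases j
  exacts [one_pos, one_pos, a3, one_pos, one_pos, a3]

/-! ### The Kippenhahn polynomial -/

/-- Three-term recursion for the determinant of a tridiagonal matrix. -/
theorem Matrix.det_succ_succ_of_tridiagonal {R : Type*} [CommRing R] {n : ℕ}
    (M : Matrix (Fin (n + 2)) (Fin (n + 2)) R) (hr : ∀ j : Fin n, M 0 j.succ.succ = 0)
    (hc : ∀ i : Fin n, M i.succ.succ 0 = 0) :
    M.det = M 0 0 * (M.submatrix Fin.succ Fin.succ).det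
      - M 0 1 * M 1 0 * ((M.submatrix Fin.succ Fin.succ).submatrix Fin.succ Fin.succ).det := by
  have h : (M.submatrix Fin.succ (Fin.succAbove 1)).det
      = M 1 0 * ((M.submatrix Fin.succ Fin.succ).submatrix Fin.succ Fin.succ).det := by
    rw [Matrix.det_succ_column_zero, Fin.sum_univ_succ, Finset.sum_eq_zero]
    · simp only [Fin.val_zero, pow_zero, one_mul, add_zero, Matrix.submatrix_apply]
      congr 2
    · intro i _
      have : M i.succ.succ 0 = 0 := hc i
      simp [this]
  rw [Matrix.det_succ_row_zero, Fin.sum_univ_succ, Fin.sum_univ_succ, Finset.sum_eq_zero]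
  · have h1 : Fin.succ (0 : Fin (n + 1)) = 1 := rfl
    rw [h1, h]
    simp
    ring
  · intro j _
    simp [hr]

/-- For `ab = 1` the product is `(|a|² + |b|² + 2 cos 2θ) / 4`, and `|a| |b| = 1` completes the
square. -/
theorem matrixRe_mul_matrixRe {n : ℕ} {A : Matrix (Fin n) (Fin n) ℂ} (hA : IsReciprocalZeroDiag A)
    (θ : ℝ) {i j : Fin n} (hij : (i : ℕ) + 1 = j) :
    matrixRe (Complex.exp (θ * Complex.I) • A) i j * matrixRe (Complex.exp (θ * Complex.I) • A) j i
      = (((‖A i j‖ - ‖A j i‖) ^ 2 / 4 + Real.cos θ ^ 2 : ℝ) : ℂ) := by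
  have hab := hA.mul_eq_one i j hij
  have hn : ‖A i j‖ * ‖A j i‖ = 1 := by rw [← norm_mul, hab, norm_one]
  have hn' : ((‖A i j‖ : ℂ)) * ‖A j i‖ = 1 := by exact_mod_cast hn
  have hab' : (starRingEnd ℂ) (A i j) * (starRingEnd ℂ) (A j i) = 1 := by
    rw [← map_mul, hab, map_one]
  have ha : A i j * (starRingEnd ℂ) (A i j) = (‖A i j‖ : ℂ) ^ 2 := Complex.mul_conj' _
  have hb : A j i * (starRingEnd ℂ) (A j i) = (‖A j i‖ : ℂ) ^ 2 := Complex.mul_conj' _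
  have he : (starRingEnd ℂ) (Complex.exp (θ * Complex.I)) = Complex.exp (-(θ * Complex.I)) := by
    rw [← Complex.exp_conj]
    simp
  have hee : Complex.exp (θ * Complex.I) * Complex.exp (-(θ * Complex.I)) = 1 := by
    rw [← Complex.exp_add, add_neg_cancel, Complex.exp_zero]
  have hcos : Complex.exp (θ * Complex.I) + Complex.exp (-(θ * Complex.I)) = 2 * Complex.cos θ := by
    rw [Complex.cos, neg_mul]
    ring
  simp only [matrixRe, Matrix.smul_apply, Matrix.add_apply, Matrix.conjTranspose_apply,
    smul_eq_mul, star_mul', Complex.star_def, he]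
  push_cast
  rw [show Complex.cos θ ^ 2 = (2 * Complex.cos θ) ^ 2 / 4 by ring, ← hcos]
  generalize Complex.exp (θ * Complex.I) = e at *
  generalize Complex.exp (-(θ * Complex.I)) = e' at *
  linear_combination (1 / 4) * (e ^ 2 * hab + e' ^ 2 * hab' + e * e' * (ha + hb)
    + (‖A i j‖ ^ 2 + ‖A j i‖ ^ 2 - 2) * hee) + 1 / 2 * hn'

theorem kippenhahnPoly_eq {A : Matrix (Fin 7) (Fin 7) ℂ} (hA : IsReciprocalZeroDiag A) (x θ : ℝ) :
    kippenhahnPoly A x θ = ((-x * polyP7 (xi A) (Real.cos θ ^ 2) (x ^ 2) : ℝ) : ℂ) := by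
  set M := matrixRe (Complex.exp (θ * Complex.I) • A) - (x : ℂ) • (1 : Matrix (Fin 7) (Fin 7) ℂ)
    with hM
  have hd : ∀ i, M i i = -x := fun i => by
    simp [hM, matrixRe, hA.diag_eq_zero]
  have hz : ∀ i j : Fin 7, (i : ℕ) + 1 < j ∨ (j : ℕ) + 1 < i → M i j = 0 := fun i j h => by
    have hne : i ≠ j := by
      rintro rfl
      omega
    simp [hM, matrixRe, hA.tridiagonal i j h, hA.tridiagonal j i h.symm, hne]
  have hp : ∀ i j : Fin 7, (i : ℕ) + 1 = j →
      M i j * M j i = (((‖A i j‖ - ‖A j i‖) ^ 2 / 4 + Real.cos θ ^ 2 : ℝ) : ℂ) := fun i j h => by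
    have hne : i ≠ j := by
      rintro rfl
      omega
    rw [← matrixRe_mul_matrixRe hA θ h]
    simp [hM, hne, hne.symm]
  change M.det = _
  have p0 := hp 0 1 rfl
  have p1 := hp 1 2 rfl
  have p2 := hp 2 3 rfl
  have p3 := hp 3 4 rfl
  have p4 := hp 4 5 rfl
  have p5 := hp 5 6 rfl
  change M 0 1 * M 1 0 = ((xi A 0 + Real.cos θ ^ 2 : ℝ) : ℂ) at p0
  change M 1 2 * M 2 1 = ((xi A 1 + Real.cos θ ^ 2 : ℝ) : ℂ) at p1
  change M 2 3 * M 3 2 = ((xi A 2 + Real.cos θ ^ 2 : ℝ) : ℂ) at p2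
  change M 3 4 * M 4 3 = ((xi A 3 + Real.cos θ ^ 2 : ℝ) : ℂ) at p3
  change M 4 5 * M 5 4 = ((xi A 4 + Real.cos θ ^ 2 : ℝ) : ℂ) at p4
  change M 5 6 * M 6 5 = ((xi A 5 + Real.cos θ ^ 2 : ℝ) : ℂ) at p5
  rw [polyP7_eq]
  generalize xi A = ξ at *
  generalize Real.cos θ ^ 2 = ρ at *
  -- The three-term recursion for the trailing principal block starting at index `k`.
  have hr : ∀ {n : ℕ} (f : Fin (n + 2) → Fin 7) (k : ℕ), (∀ i, (f i : ℕ) = i + k) →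
      (M.submatrix f f).det = -x * ((M.submatrix f f).submatrix Fin.succ Fin.succ).det
      - M (f 0) (f 1) * M (f 1) (f 0) *
        (((M.submatrix f f).submatrix Fin.succ Fin.succ).submatrix Fin.succ Fin.succ).det := by
    intro n f k hf
    rw [Matrix.det_succ_succ_of_tridiagonal, Matrix.submatrix_apply, hd]
    · rfl
    · intro j
      apply hz
      left
      rw [hf, hf]
      simp
      omega
    · intro j
      apply hz
      right
      rw [hf, hf]
      simp
      omega
  have e0 := hr (n := 5) id 0 (fun i => rfl)
  have e1 := hr (n := 4) (fun i => i.succ) 1 (fun i => rfl)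
  have e2 := hr (n := 3) (fun i => i.succ.succ) 2 (fun i => rfl)
  have e3 := hr (n := 2) (fun i => i.succ.succ.succ) 3 (fun i => rfl)
  have e4 := hr (n := 1) (fun i => i.succ.succ.succ.succ) 4 (fun i => rfl)
  have e5 := hr (n := 0) (fun i => i.succ.succ.succ.succ.succ) 5 (fun i => rfl)
  have d6 : (M.submatrix (fun i : Fin 1 => i.succ.succ.succ.succ.succ.succ)
      (fun i : Fin 1 => i.succ.succ.succ.succ.succ.succ)).det = -x := by
    rw [Matrix.det_unique]
    exact hd _
  have d7 : (M.submatrix (fun i : Fin 0 => i.succ.succ.succ.succ.succ.succ.succ)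
      (fun i : Fin 0 => i.succ.succ.succ.succ.succ.succ.succ)).det = 1 := Matrix.det_isEmpty
  simp only [Matrix.submatrix_submatrix, Function.comp_def, Matrix.submatrix_id_id, id]
    at e0 e1 e2 e3 e4 e5
  change _ = _ - M 0 1 * M 1 0 * _ at e0
  change _ = _ - M 1 2 * M 2 1 * _ at e1
  change _ = _ - M 2 3 * M 3 2 * _ at e2
  change _ = _ - M 3 4 * M 4 3 * _ at e3
  change _ = _ - M 4 5 * M 5 4 * _ at e4
  change _ = _ - M 5 6 * M 6 5 * _ at e5
  rw [p0] at e0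
  rw [p1] at e1
  rw [p2] at e2
  rw [p3] at e3
  rw [p4] at e4
  rw [p5, d6, d7] at e5
  rw [e5, d6] at e4
  rw [e4, e5] at e3
  rw [e3, e4] at e2
  rw [e2, e3] at e1
  rw [e1, e2] at e0
  rw [e0]
  push_cast
  ring

/-! ### Ellipses and their tangent lines -/

/-- The point of the envelope of the lines `Re (e^{iθ} z) = l θ` on the line with parameter `θ`. -/
noncomputable def envelopePoint (l : ℝ → ℝ) (θ : ℝ) : ℂ :=
  Complex.exp (-(θ * Complex.I)) * ((l θ : ℂ) - Complex.I * ((deriv l θ : ℝ) : ℂ))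

theorem envelopePoint_re_im (l : ℝ → ℝ) (θ : ℝ) :
    (envelopePoint l θ).re = l θ * Real.cos θ - deriv l θ * Real.sin θ ∧
      (envelopePoint l θ).im = -(l θ * Real.sin θ) - deriv l θ * Real.cos θ := by
  have h : Complex.exp (-(θ * Complex.I)) = ⟨Real.cos θ, -Real.sin θ⟩ := by
    rw [← neg_mul, ← Complex.ofReal_neg, Complex.exp_mul_I, ← Complex.ofReal_cos,
      ← Complex.ofReal_sin]
    apply Complex.ext <;> simp [-Complex.ofReal_cos, -Complex.ofReal_sin]
  rw [envelopePoint, h]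
  constructor
  · simp
    ring
  · simp
    ring

/-- With `a` the major half-axis and `u = z.re - m`, both descriptions amount to the focal radii
being `a ∓ uX/a`. -/
theorem mem_ellipse_iff {m X c : ℝ} (hX : 0 < X) (hc : 0 < c) (z : ℂ) :
    z ∈ ellipse ((m + X : ℝ) : ℂ) ((m - X : ℝ) : ℂ) c ↔
      c ^ 2 * (z.re - m) ^ 2 + (c ^ 2 + X ^ 2) * z.im ^ 2 = (c ^ 2 + X ^ 2) * c ^ 2 := by
  have hfg : dist ((m + X : ℝ) : ℂ) ((m - X : ℝ) : ℂ) / 2 = X := by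
    rw [Complex.dist_eq, ← Complex.ofReal_sub, Complex.norm_real, Real.norm_eq_abs,
      show m + X - (m - X) = 2 * X by ring, abs_of_pos (by positivity)]
    ring
  obtain ⟨a, ha, ha2⟩ : ∃ a : ℝ, 0 < a ∧ a ^ 2 = c ^ 2 + X ^ 2 :=
    ⟨√(c ^ 2 + X ^ 2), by positivity, Real.sq_sqrt (by positivity)⟩
  have hd : ∀ t : ℝ, 0 ≤ dist z (t : ℂ) ∧ dist z (t : ℂ) ^ 2 = (z.re - t) ^ 2 + z.im ^ 2 :=
    fun t => ⟨dist_nonneg, by rw [Complex.dist_eq, Complex.sq_norm, Complex.normSq_apply]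
                              simp; ring⟩
  obtain ⟨h1, h1'⟩ := hd (m + X)
  obtain ⟨h2, h2'⟩ := hd (m - X)
  change _ = _ ↔ _
  rw [hfg, ← ha2, Real.sqrt_sq ha.le]
  generalize dist z ((m + X : ℝ) : ℂ) = p at *
  generalize dist z ((m - X : ℝ) : ℂ) = q at *
  obtain ⟨u, hu⟩ : ∃ u, u = z.re - m := ⟨_, rfl⟩
  have e1 : p ^ 2 = (u - X) ^ 2 + z.im ^ 2 := by rw [h1', hu]; ring
  have e2 : q ^ 2 = (u + X) ^ 2 + z.im ^ 2 := by rw [h2', hu]; ring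
  rw [← hu]
  clear h1' h2' hu hd hfg
  constructor
  · intro h
    have hq : a * (q - p) = 2 * u * X := by
      linear_combination (e2 - e1) / 2 - (q - p) / 2 * h
    have hq' : a * q = a ^ 2 + u * X := by linear_combination (a * h + hq) / 2
    have : (a * q) ^ 2 = (a ^ 2 + u * X) ^ 2 := by rw [hq']
    linear_combination this - a ^ 2 * e2 + (a ^ 2 - u ^ 2) * ha2
  · intro h
    have hau : u ^ 2 ≤ a ^ 2 := by
      have : 0 ≤ a ^ 2 * z.im ^ 2 := by positivity
      have : c ^ 2 * u ^ 2 ≤ c ^ 2 * a ^ 2 := by linarith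
      exact le_of_mul_le_mul_left this (by positivity)
    have hau := abs_le_of_sq_le_sq hau ha.le
    have hXa : X < a := by
      refine lt_of_pow_lt_pow_left₀ 2 ha.le ?_
      have : 0 < c ^ 2 := by positivity
      linarith
    have n1 : 0 ≤ a ^ 2 - u * X := by nlinarith
    have n2 : 0 ≤ a ^ 2 + u * X := by nlinarith
    have hp : a * p = a ^ 2 - u * X := by
      refine (pow_left_inj₀ (by positivity) n1 two_ne_zero).1 ?_
      linear_combination a ^ 2 * e1 + h - (a ^ 2 - u ^ 2) * ha2
    have hq : a * q = a ^ 2 + u * X := by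
      refine (pow_left_inj₀ (by positivity) n2 two_ne_zero).1 ?_
      linear_combination a ^ 2 * e2 + h - (a ^ 2 - u ^ 2) * ha2
    refine mul_left_cancel₀ ha.ne' ?_
    linear_combination hp + hq

/-- Support function of the ellipse with foci `m ± X` and minor half-axis `c` (for `ε = 1`). -/
noncomputable def ellipseSupport (m X c ε : ℝ) (θ : ℝ) : ℝ :=
  m * Real.cos θ + ε * √(c ^ 2 + X ^ 2 * Real.cos θ ^ 2)

theorem analyticAt_ellipseSupport {m X c : ℝ} (hc : 0 < c) (ε θ : ℝ) :
    AnalyticAt ℝ (ellipseSupport m X c ε) θ := by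
  have hpos : 0 < c ^ 2 + X ^ 2 * Real.cos θ ^ 2 := by positivity
  have hcos : AnalyticAt ℝ Real.cos θ := Real.analyticAt_cos
  have h1 : AnalyticAt ℝ (fun θ => c ^ 2 + X ^ 2 * Real.cos θ ^ 2) θ := by fun_prop
  have h2 : AnalyticAt ℝ (fun θ => √(c ^ 2 + X ^ 2 * Real.cos θ ^ 2)) θ := by
    have h3 : AnalyticAt ℝ (fun x : ℝ => √x) (c ^ 2 + X ^ 2 * Real.cos θ ^ 2) :=
      (Real.contDiffAt_sqrt hpos.ne').analyticAt
    exact h3.comp_of_eq h1 rfl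
  unfold ellipseSupport
  fun_prop

theorem hasDerivAt_ellipseSupport {m X c : ℝ} (hc : 0 < c) (ε θ : ℝ) :
    HasDerivAt (ellipseSupport m X c ε) (-(m * Real.sin θ) - ε * (X ^ 2 * Real.cos θ * Real.sin θ /
      √(c ^ 2 + X ^ 2 * Real.cos θ ^ 2))) θ := by
  have hpos : 0 < c ^ 2 + X ^ 2 * Real.cos θ ^ 2 := by positivity
  have h1 : HasDerivAt (fun θ => c ^ 2 + X ^ 2 * Real.cos θ ^ 2)
      (X ^ 2 * (2 * Real.cos θ * -Real.sin θ)) θ := by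
    have := (((Real.hasDerivAt_cos θ).pow 2).const_mul (X ^ 2)).const_add (c ^ 2)
    exact this.congr_deriv (by norm_num)
  have h2 := ((Real.hasDerivAt_cos θ).const_mul m).add ((h1.sqrt hpos.ne').const_mul ε)
  refine h2.congr_deriv ?_
  have : √(c ^ 2 + X ^ 2 * Real.cos θ ^ 2) ≠ 0 := (Real.sqrt_pos.2 hpos).ne'
  field_simp
  ring

theorem envelopePoint_ellipseSupport {m X c : ℝ} (hc : 0 < c) (ε θ : ℝ) :
    envelopePoint (ellipseSupport m X c ε) θ =
      ⟨m + ε * ((c ^ 2 + X ^ 2) * Real.cos θ / √(c ^ 2 + X ^ 2 * Real.cos θ ^ 2)),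
        -(ε * (c ^ 2 * Real.sin θ / √(c ^ 2 + X ^ 2 * Real.cos θ ^ 2)))⟩ := by
  have hpos : 0 < c ^ 2 + X ^ 2 * Real.cos θ ^ 2 := by positivity
  have hσ := Real.sq_sqrt hpos.le
  have hσ0 : √(c ^ 2 + X ^ 2 * Real.cos θ ^ 2) ≠ 0 := (Real.sqrt_pos.2 hpos).ne'
  have hcs := Real.sin_sq_add_cos_sq θ
  obtain ⟨h1, h2⟩ := envelopePoint_re_im (ellipseSupport m X c ε) θ
  rw [(hasDerivAt_ellipseSupport hc ε θ).deriv, ellipseSupport] at h1 h2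
  generalize √(c ^ 2 + X ^ 2 * Real.cos θ ^ 2) = σ at *
  generalize Real.cos θ = C at *
  generalize Real.sin θ = S at *
  apply Complex.ext
  · rw [h1]
    field_simp
    linear_combination (ε * C) * hσ + (m * σ + ε * X ^ 2 * C) * hcs
  · rw [h2]
    field_simp
    linear_combination (-ε * S) * hσ

/-- Each sign `ε` alone traces the whole ellipse, because `θ ↦ θ + π` only reverses the normal. -/
theorem mem_ellipse_iff_exists {m X c : ℝ} (hX : 0 < X) (hc : 0 < c) {ε : ℝ} (hε : ε ^ 2 = 1)
    (z : ℂ) : z ∈ ellipse ((m + X : ℝ) : ℂ) ((m - X : ℝ) : ℂ) c ↔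
      ∃ θ, z = envelopePoint (ellipseSupport m X c ε) θ := by
  rw [mem_ellipse_iff hX hc]
  constructor
  · intro h
    obtain ⟨a, ha⟩ : ∃ a, a = c ^ 2 + X ^ 2 := ⟨_, rfl⟩
    have ha0 : 0 < a := by rw [ha]; positivity
    have hc0 := hc.ne'
    rw [← ha] at h
    obtain ⟨u, hu⟩ : ∃ u, u = z.re - m := ⟨_, rfl⟩
    rw [← hu] at h
    have hN : 0 < (u / a) ^ 2 + (z.im / c ^ 2) ^ 2 := by
      by_contra hneg
      have h1 : (u / a) ^ 2 = 0 := by nlinarith [sq_nonneg (u / a), sq_nonneg (z.im / c ^ 2)]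
      have h2 : (z.im / c ^ 2) ^ 2 = 0 := by
        nlinarith [sq_nonneg (u / a), sq_nonneg (z.im / c ^ 2)]
      have h1' : u = 0 := by simpa [ha0.ne'] using h1
      have h2' : z.im = 0 := by simpa [hc0] using h2
      rw [h1', h2'] at h
      have : 0 < a * c ^ 2 := by positivity
      nlinarith
    obtain ⟨N, hN0, hN2⟩ : ∃ N : ℝ, 0 < N ∧ N ^ 2 = (u / a) ^ 2 + (z.im / c ^ 2) ^ 2 :=
      ⟨_, Real.sqrt_pos.2 hN, Real.sq_sqrt hN.le⟩
    -- The angle is read off the normal `(u / a, z.im / c²)` of length `N`; here `a` is the square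
    -- of the major half-axis.
    obtain ⟨θ, hcos, hsin⟩ : ∃ θ, Real.cos θ = ε * (u / a / N) ∧
        Real.sin θ = -(ε * (z.im / c ^ 2 / N)) := by
      let w : ℂ := ⟨ε * (u / a / N), -(ε * (z.im / c ^ 2 / N))⟩
      have hw : ‖w‖ = 1 := by
        rw [← sq_eq_sq₀ (norm_nonneg _) zero_le_one, Complex.sq_norm, Complex.normSq_apply]
        change ε * (u / a / N) * (ε * (u / a / N))
          + -(ε * (z.im / c ^ 2 / N)) * -(ε * (z.im / c ^ 2 / N)) = 1 ^ 2
        have : ε * (u / a / N) * (ε * (u / a / N))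
          + -(ε * (z.im / c ^ 2 / N)) * -(ε * (z.im / c ^ 2 / N))
          = ε ^ 2 * (((u / a) ^ 2 + (z.im / c ^ 2) ^ 2) / N ^ 2) := by ring
        rw [this, ← hN2, hε, div_self (by positivity)]
        norm_num
      have hw0 : w ≠ 0 := by
        intro h0
        rw [h0, norm_zero] at hw
        exact zero_ne_one hw
      exact ⟨w.arg, by rw [Complex.cos_arg hw0, hw, div_one],
        by rw [Complex.sin_arg, hw, div_one]⟩
    have hσ : √(c ^ 2 + X ^ 2 * Real.cos θ ^ 2) = 1 / N := by
      have : c ^ 2 + X ^ 2 * Real.cos θ ^ 2 = (1 / N) ^ 2 := by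
        have e : c ^ 2 + X ^ 2 * Real.cos θ ^ 2 = a * Real.cos θ ^ 2 + c ^ 2 * Real.sin θ ^ 2 := by
          rw [ha]
          linear_combination (-c ^ 2) * Real.sin_sq_add_cos_sq θ
        rw [e, hcos, hsin]
        field_simp
        rw [hε]
        linear_combination h
      rw [this, Real.sqrt_sq (by positivity)]
    refine ⟨θ, ?_⟩
    rw [envelopePoint_ellipseSupport hc, hσ, hcos, hsin, ← ha]
    apply Complex.ext
    · field_simp
      rw [hε, hu]
      ring
    · field_simp
      rw [hε]
      ring
  · rintro ⟨θ, rfl⟩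
    rw [envelopePoint_ellipseSupport hc]
    have hpos : 0 < c ^ 2 + X ^ 2 * Real.cos θ ^ 2 := by positivity
    have hσ := Real.sq_sqrt hpos.le
    have hσ0 : √(c ^ 2 + X ^ 2 * Real.cos θ ^ 2) ≠ 0 := (Real.sqrt_pos.2 hpos).ne'
    have hcs := Real.sin_sq_add_cos_sq θ
    generalize √(c ^ 2 + X ^ 2 * Real.cos θ ^ 2) = σ at *
    generalize Real.cos θ = C at *
    generalize Real.sin θ = S at *
    simp only [add_sub_cancel_left]
    field_simp
    rw [hε, hσ]
    linear_combination c ^ 2 * hcs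

/-- If the Kippenhahn polynomial has globally defined analytic roots, the Kippenhahn curve is the
union of their envelopes. -/
theorem kippenhahnCurve_eq_of_roots {n : ℕ} {A : Matrix (Fin n) (Fin n) ℂ} {ι : Type*} [Finite ι]
    (g : ι → ℝ → ℝ) (hg : ∀ k θ, AnalyticAt ℝ (g k) θ)
    (h : ∀ x θ, kippenhahnPoly A x θ = 0 ↔ ∃ k, x = g k θ) :
    kippenhahnCurve A = {z | ∃ k θ, z = envelopePoint (g k) θ} := by
  ext z
  constructor
  · rintro ⟨θ, l, hl, hr, rfl⟩
    -- Pigeonhole over finitely many roots; the identity theorem then makes the germs of `l` and `g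
    -- k` equal, derivatives included.
    have hfreq : ∃ k, ∃ᶠ s in 𝓝[≠] θ, l s = g k s := by
      by_contra hneg
      push Not at hneg
      have h1 : ∀ᶠ s in 𝓝[≠] θ, ∀ k, l s ≠ g k s := Filter.eventually_all.2 hneg
      have h2 : ∀ᶠ s in 𝓝[≠] θ, kippenhahnPoly A (l s) s = 0 := nhdsWithin_le_nhds hr
      obtain ⟨s, hs1, hs2⟩ := (h1.and h2).exists
      obtain ⟨k, hk⟩ := (h _ _).1 hs2
      exact hs1 k hk
    obtain ⟨k, hk⟩ := hfreq
    have heq := (hl.frequently_eq_iff_eventually_eq (hg k θ)).1 hk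
    refine ⟨k, θ, ?_⟩
    rw [envelopePoint, ← Filter.EventuallyEq.eq_of_nhds heq, ← Filter.EventuallyEq.deriv_eq heq]
  · rintro ⟨k, θ, rfl⟩
    exact ⟨θ, g k, hg k θ, Filter.Eventually.of_forall fun s => (h _ _).2 ⟨k, rfl⟩, rfl⟩

/-! ### Analytic arcs of the Kippenhahn curve -/

/-- Zeros of a nonzero analytic function on a connected set are isolated, and a discrete subset of
`ℝ` is countable. -/
theorem AnalyticOnNhd.eqOn_zero_of_not_countable {f : ℝ → ℝ} {U Z : Set ℝ}
    (hf : AnalyticOnNhd ℝ f U) (hU : IsPreconnected U) (hZU : Z ⊆ U) (hZ : ¬ Z.Countable)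
    (h0 : ∀ z ∈ Z, f z = 0) : ∀ z ∈ U, f z = 0 := by
  by_contra hne
  refine hZ ?_
  have hd : DiscreteTopology Z := by
    rw [discreteTopology_subtype_iff]
    intro z hz
    have : ∀ᶠ s in 𝓝[≠] z, f s ≠ 0 := by
      by_contra hfr
      exact hne (hf.eqOn_zero_of_preconnected_of_frequently_eq_zero hU (hZU hz)
        ((Filter.not_eventually.1 hfr).mono fun s hs => not_not.1 hs))
    rw [← disjoint_iff]
    refine Filter.disjoint_principal_right.2 ?_
    filter_upwards [this] with s hs hsZ
    exact hs (h0 s hsZ)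
  exact Set.countable_coe_iff.1 countable_of_Lindelof_of_discrete

theorem card_le_of_kippenhahnPoly_eq_zero {n : ℕ} (A : Matrix (Fin n) (Fin n) ℂ) (θ : ℝ)
    (T : Finset ℝ) (hT : ∀ x ∈ T, kippenhahnPoly A x θ = 0) : T.card ≤ n := by
  set M := matrixRe (Complex.exp (θ * Complex.I) • A) with hM
  have hsub : T.image (fun x : ℝ => (x : ℂ)) ⊆ M.charpoly.roots.toFinset := by
    intro y hy
    obtain ⟨x, hx, rfl⟩ := Finset.mem_image.1 hy
    rw [Multiset.mem_toFinset, Polynomial.mem_roots M.charpoly_monic.ne_zero, Polynomial.IsRoot,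
      Matrix.eval_charpoly, ← neg_sub, Matrix.det_neg]
    have := hT x hx
    rw [kippenhahnPoly, ← hM, ← Matrix.diagonal_one, ← Matrix.diagonal_smul] at this
    have e : (x : ℂ) • (1 : Fin n → ℂ) = fun _ => (x : ℂ) := by
      funext i
      simp
    rw [Matrix.scalar_apply]
    change Matrix.det (M - Matrix.diagonal ((x : ℂ) • (1 : Fin n → ℂ))) = 0 at this
    rw [e] at this
    rw [this, mul_zero]
  calc T.card = (T.image (fun x : ℝ => (x : ℂ))).card :=
        (Finset.card_image_of_injective _ Complex.ofReal_injective).symm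
    _ ≤ M.charpoly.roots.toFinset.card := Finset.card_le_card hsub
    _ ≤ Multiset.card M.charpoly.roots := Multiset.toFinset_card_le _
    _ ≤ M.charpoly.natDegree := M.charpoly.card_roots'
    _ = n := by rw [Matrix.charpoly_natDegree_eq_dim, Fintype.card_fin]

/-- Among `n + 1` distinct branches any two agree only on a countable set, so at some parameter all
values differ: too many eigenvalues. -/
theorem finite_analytic_roots {n : ℕ} (A : Matrix (Fin n) (Fin n) ℂ) {U : Set ℝ}
    (hU : IsPreconnected U) (hUc : ¬ U.Countable) :
    {f : U → ℝ | ∃ l : ℝ → ℝ, AnalyticOnNhd ℝ l U ∧ (∀ s ∈ U, kippenhahnPoly A (l s) s = 0) ∧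
      f = U.domRestrict l}.Finite := by
  by_contra hinf
  obtain ⟨t, ht, htc⟩ := Set.Infinite.exists_subset_card_eq hinf (n + 1)
  have hcount : ∀ p ∈ t.offDiag, {s : U | p.1 s = p.2 s}.Countable := by
    rintro ⟨f, g⟩ hp
    obtain ⟨hf, hg, hfg⟩ := Finset.mem_offDiag.1 hp
    obtain ⟨l, hl, -, rfl⟩ := ht hf
    obtain ⟨k, hk, -, rfl⟩ := ht hg
    by_contra hc
    refine hfg (funext fun s => sub_eq_zero.1 ?_)
    refine (hl.sub hk).eqOn_zero_of_not_countable hU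
      (Z := Subtype.val '' {s : U | U.domRestrict l s = U.domRestrict k s}) ?_ ?_ ?_ s s.2
    · rintro _ ⟨s, -, rfl⟩
      exact s.2
    · intro hc'
      exact hc (Set.countable_of_injective_of_countable_image Subtype.val_injective.injOn hc')
    · rintro _ ⟨s, hs, rfl⟩
      exact sub_eq_zero.2 hs
  have hbad := Set.Countable.biUnion (t.offDiag.finite_toSet.countable) hcount
  have : ∃ s : U, s ∉ ⋃ p ∈ (t.offDiag : Set ((U → ℝ) × (U → ℝ))), {s : U | p.1 s = p.2 s} := by
    by_contra hall
    push Not at hall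
    rw [← Set.eq_univ_iff_forall] at hall
    rw [hall, Set.countable_univ_iff] at hbad
    exact hUc (Set.countable_coe_iff.1 hbad)
  obtain ⟨s, hs⟩ := this
  have hinj : Set.InjOn (fun f : U → ℝ => f s) t := by
    intro f hf g hg hfg
    by_contra hne
    exact hs (Set.mem_biUnion (x := (f, g)) (Finset.mem_coe.2 (Finset.mem_offDiag.2
      ⟨hf, hg, hne⟩)) hfg)
  have := card_le_of_kippenhahnPoly_eq_zero A s (t.image fun f => f s) (by
    intro x hx
    obtain ⟨f, hf, rfl⟩ := Finset.mem_image.1 hx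
    obtain ⟨l, -, hl, rfl⟩ := ht hf
    exact hl s s.2)
  rw [Finset.card_image_of_injOn hinj, htc] at this
  omega

/-- Each local branch restricts to an interval with rational endpoints. There are countably many
such intervals, each carrying finitely many branches, so some arc contains uncountably many points
of `S`. -/
theorem exists_arc_of_subset_kippenhahnCurve {n : ℕ} {A : Matrix (Fin n) (Fin n) ℂ} {S : Set ℂ}
    (hS : ¬ S.Countable) (hSA : S ⊆ kippenhahnCurve A) :
    ∃ (a b : ℝ) (l : ℝ → ℝ), a < b ∧ AnalyticOnNhd ℝ l (Set.Ioo a b) ∧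
      (∀ s ∈ Set.Ioo a b, kippenhahnPoly A (l s) s = 0) ∧
      ¬ (S ∩ envelopePoint l '' Set.Ioo a b).Countable := by
  by_contra hcon
  push Not at hcon
  refine hS ?_
  have hcov : S ⊆ ⋃ q : ℚ × ℚ, {z | z ∈ S ∧ (q.1 : ℝ) < q.2 ∧ ∃ l : ℝ → ℝ,
      AnalyticOnNhd ℝ l (Set.Ioo (q.1 : ℝ) q.2) ∧
      (∀ s ∈ Set.Ioo (q.1 : ℝ) q.2, kippenhahnPoly A (l s) s = 0) ∧
      ∃ θ ∈ Set.Ioo (q.1 : ℝ) q.2, z = envelopePoint l θ} := by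
    intro z hz
    obtain ⟨θ, l, hl, hr, hzl⟩ := hSA hz
    obtain ⟨ε, hε, hball⟩ := Metric.eventually_nhds_iff_ball.1 (hl.eventually_analyticAt.and hr)
    obtain ⟨p, hp1, hp2⟩ := exists_rat_btwn (show θ - ε < θ by linarith)
    obtain ⟨q, hq1, hq2⟩ := exists_rat_btwn (show θ < θ + ε by linarith)
    have hsub : ∀ s ∈ Set.Ioo (p : ℝ) q, s ∈ Metric.ball θ ε := by
      intro s hs
      rw [Real.ball_eq_Ioo]
      exact ⟨hp1.trans hs.1, hs.2.trans hq2⟩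
    exact Set.mem_iUnion.2 ⟨(p, q), hz, hp2.trans hq1, l, fun s hs => (hball s (hsub s hs)).1,
      fun s hs => (hball s (hsub s hs)).2, θ, ⟨hp2, hq1⟩, hzl⟩
  refine Set.Countable.mono hcov (Set.countable_iUnion fun q => ?_)
  by_cases hq : (q.1 : ℝ) < q.2
  swap
  · refine Set.Countable.mono (fun z hz => ?_) Set.countable_empty
    exact absurd hz.2.1 hq
  have hfin := finite_analytic_roots A (isPreconnected_Ioo (a := (q.1 : ℝ)) (b := q.2))
    (fun h => not_lt.2 (Cardinal.Real.Ioo_countable_iff.1 h) hq)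
  refine Set.Countable.mono ?_ (Set.Countable.biUnion hfin.countable (t := fun f _ => S ∩
    {z | ∃ l : ℝ → ℝ, AnalyticOnNhd ℝ l (Set.Ioo (q.1 : ℝ) q.2) ∧
      (∀ s ∈ Set.Ioo (q.1 : ℝ) q.2, kippenhahnPoly A (l s) s = 0) ∧
      f = (Set.Ioo (q.1 : ℝ) q.2).domRestrict l ∧
      ∃ θ ∈ Set.Ioo (q.1 : ℝ) q.2, z = envelopePoint l θ}) ?_)
  · rintro z ⟨hz, -, l, hl, hr, hθ⟩
    exact Set.mem_biUnion (x := (Set.Ioo (q.1 : ℝ) q.2).domRestrict l) ⟨l, hl, hr, rfl⟩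
      ⟨hz, l, hl, hr, rfl, hθ⟩
  · rintro f ⟨l, hl, hr, rfl⟩
    refine Set.Countable.mono ?_ (hcon _ _ l hq hl hr)
    rintro z ⟨hz, k, -, -, hkl, θ, hθ, rfl⟩
    have heq : l =ᶠ[𝓝 θ] k := by
      filter_upwards [isOpen_Ioo.mem_nhds hθ] with s hs
      exact congrFun hkl ⟨s, hs⟩
    refine ⟨hz, θ, hθ, ?_⟩
    rw [envelopePoint, envelopePoint, heq.eq_of_nhds, heq.deriv_eq]

theorem not_countable_ellipse {m X c : ℝ} (hX : 0 < X) (hc : 0 < c) :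
    ¬ (ellipse ((m + X : ℝ) : ℂ) ((m - X : ℝ) : ℂ) c).Countable := by
  intro h
  have h1 := h.image Complex.re
  have h2 : Set.Ioo m (m + X) ⊆
      Complex.re '' (ellipse ((m + X : ℝ) : ℂ) ((m - X : ℝ) : ℂ) c) := by
    intro x hx
    have hx2 : (x - m) ^ 2 ≤ X ^ 2 := pow_le_pow_left₀ (by linarith [hx.1]) (by linarith [hx.2]) 2
    have hpos : 0 ≤ c ^ 2 * (c ^ 2 + X ^ 2 - (x - m) ^ 2) / (c ^ 2 + X ^ 2) :=
      div_nonneg (mul_nonneg (sq_nonneg c) (by linarith [sq_nonneg c])) (by positivity)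
    refine ⟨⟨x, √(c ^ 2 * (c ^ 2 + X ^ 2 - (x - m) ^ 2) / (c ^ 2 + X ^ 2))⟩, ?_, rfl⟩
    rw [mem_ellipse_iff hX hc]
    simp only
    rw [Real.sq_sqrt hpos]
    field_simp
    ring
  have := Cardinal.Real.Ioo_countable_iff.1 (h1.mono h2)
  linarith

/-- An analytic family of lines, uncountably many of whose envelope points lie on an ellipse,
consists of tangent lines of the ellipse. -/
theorem sq_eq_of_envelope_meets_ellipse {m X c a b : ℝ} {l : ℝ → ℝ} (hX : 0 < X) (hc : 0 < c)
    (hl : AnalyticOnNhd ℝ l (Set.Ioo a b))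
    (h : ¬ (ellipse ((m + X : ℝ) : ℂ) ((m - X : ℝ) : ℂ) c
      ∩ envelopePoint l '' Set.Ioo a b).Countable) :
    ∀ s ∈ Set.Ioo a b, (l s - m * Real.cos s) ^ 2 = c ^ 2 + X ^ 2 * Real.cos s ^ 2 := by
  set I := Set.Ioo a b with hI
  have hIo : IsOpen I := isOpen_Ioo
  have hIp : IsPreconnected I := isPreconnected_Ioo
  have hsin : AnalyticOnNhd ℝ Real.sin I := fun s _ => Real.analyticAt_sin
  have hcos : AnalyticOnNhd ℝ Real.cos I := fun s _ => Real.analyticAt_cos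
  have hl1 : AnalyticOnNhd ℝ (deriv l) I := hl.deriv
  have hl2 : AnalyticOnNhd ℝ (deriv (deriv l)) I := hl1.deriv
  set u : ℝ → ℝ := fun s => l s * Real.cos s - deriv l s * Real.sin s - m with hu
  set v : ℝ → ℝ := fun s => -(l s * Real.sin s) - deriv l s * Real.cos s with hv
  have hua : AnalyticOnNhd ℝ u I := ((hl.mul hcos).sub (hl1.mul hsin)).sub analyticOnNhd_const
  have hva : AnalyticOnNhd ℝ v I := ((hl.mul hsin).neg).sub (hl1.mul hcos)
  have hdl : ∀ s ∈ I, HasDerivAt l (deriv l s) s := fun s hs => (hl s hs).differentiableAt.hasDerivAt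
  have hdl1 : ∀ s ∈ I, HasDerivAt (deriv l) (deriv (deriv l) s) s := fun s hs =>
    (hl1 s hs).differentiableAt.hasDerivAt
  have hdu : ∀ s ∈ I, HasDerivAt u (-((l s + deriv (deriv l) s) * Real.sin s)) s := fun s hs => by
    refine ((((hdl s hs).mul (Real.hasDerivAt_cos s)).sub
      ((hdl1 s hs).mul (Real.hasDerivAt_sin s))).sub_const m).congr_deriv ?_
    ring
  have hdv : ∀ s ∈ I, HasDerivAt v (-((l s + deriv (deriv l) s) * Real.cos s)) s := fun s hs => by
    refine (((hdl s hs).mul (Real.hasDerivAt_sin s)).neg.sub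
      ((hdl1 s hs).mul (Real.hasDerivAt_cos s))).congr_deriv ?_
    ring
  have hZ : ¬ {s | s ∈ I ∧ envelopePoint l s ∈
      ellipse ((m + X : ℝ) : ℂ) ((m - X : ℝ) : ℂ) c}.Countable := by
    intro hcount
    refine h ((hcount.image (envelopePoint l)).mono ?_)
    rintro _ ⟨hz, s, hs, rfl⟩
    exact ⟨s, ⟨hs, hz⟩, rfl⟩
  have hG : ∀ s ∈ I, c ^ 2 * u s ^ 2 + (c ^ 2 + X ^ 2) * v s ^ 2
      - (c ^ 2 + X ^ 2) * c ^ 2 = 0 := by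
    refine AnalyticOnNhd.eqOn_zero_of_not_countable (f := fun s => c ^ 2 * u s ^ 2
      + (c ^ 2 + X ^ 2) * v s ^ 2 - (c ^ 2 + X ^ 2) * c ^ 2) ?_ hIp (fun s hs => hs.1) hZ ?_
    · exact ((analyticOnNhd_const.mul (hua.pow 2)).add
        (analyticOnNhd_const.mul (hva.pow 2))).sub analyticOnNhd_const
    · rintro s ⟨-, hs⟩
      rw [mem_ellipse_iff hX hc, (envelopePoint_re_im l s).1, (envelopePoint_re_im l s).2] at hs
      exact sub_eq_zero.2 hs
  -- The derivative of the ellipse equation along the arc. If `l + l'' = 0`, the envelope is a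
  -- single point; otherwise the second factor vanishes, so the line is tangent to the ellipse.
  have hprod : ∀ s ∈ I, (l s + deriv (deriv l) s) *
      (c ^ 2 * u s * Real.sin s + (c ^ 2 + X ^ 2) * v s * Real.cos s) = 0 := by
    intro s hs
    have h1 := ((((hdu s hs).pow 2).const_mul (c ^ 2)).add
      (((hdv s hs).pow 2).const_mul (c ^ 2 + X ^ 2))).sub_const ((c ^ 2 + X ^ 2) * c ^ 2)
    have h2 : HasDerivAt (fun _ : ℝ => (0 : ℝ)) _ s := h1.congr_of_eventuallyEq (by
      filter_upwards [hIo.mem_nhds hs] with r hr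
      exact (hG r hr).symm)
    have h3 := h2.unique (hasDerivAt_const s 0)
    norm_num at h3
    linear_combination (-1 / 2) * h3
  have hW : AnalyticOnNhd ℝ (fun s => c ^ 2 * u s * Real.sin s
      + (c ^ 2 + X ^ 2) * v s * Real.cos s) I :=
    ((analyticOnNhd_const.mul hua).mul hsin).add ((analyticOnNhd_const.mul hva).mul hcos)
  rcases AnalyticOnNhd.eq_zero_or_eq_zero_of_mul_eq_zero (hl.add hl2) hW hprod hIp with h0 | h0
  · exfalso
    refine h (Set.Countable.mono Set.inter_subset_right (Set.Subsingleton.countable ?_))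
    rintro _ ⟨s, hs, rfl⟩ _ ⟨t, ht, rfl⟩
    have hcu : u s = u t := hIo.is_const_of_deriv_eq_zero hIp
      (fun r hr => (hdu r hr).differentiableAt.differentiableWithinAt)
      (fun r hr => by
        rw [(hdu r hr).deriv, show l r + deriv (deriv l) r = 0 from h0 r hr]; simp) hs ht
    have hcv : v s = v t := hIo.is_const_of_deriv_eq_zero hIp
      (fun r hr => (hdv r hr).differentiableAt.differentiableWithinAt)
      (fun r hr => by
        rw [(hdv r hr).deriv, show l r + deriv (deriv l) r = 0 from h0 r hr]; simp) hs ht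
    apply Complex.ext
    · rw [(envelopePoint_re_im l s).1, (envelopePoint_re_im l t).1]
      exact sub_left_injective hcu
    · rw [(envelopePoint_re_im l s).2, (envelopePoint_re_im l t).2]
      exact hcv
  · intro s hs
    have hGs := hG s hs
    have hWs : c ^ 2 * u s * Real.sin s + (c ^ 2 + X ^ 2) * v s * Real.cos s = 0 := h0 s hs
    have hcs := Real.sin_sq_add_cos_sq s
    have hk : l s - m * Real.cos s = u s * Real.cos s - v s * Real.sin s := by
      simp only [hu, hv]
      linear_combination (-l s) * hcs
    rw [hk]
    -- `ν` is the factor between the normal of the ellipse and the unit normal `(cos s, -sin s)` of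
    -- the line.
    obtain ⟨ν, hν⟩ : ∃ ν, ν = c ^ 2 * u s * Real.cos s - (c ^ 2 + X ^ 2) * v s * Real.sin s :=
      ⟨_, rfl⟩
    have h1 : c ^ 2 * u s = ν * Real.cos s := by
      rw [hν]; linear_combination (-c ^ 2 * u s) * hcs + Real.sin s * hWs
    have h2 : (c ^ 2 + X ^ 2) * v s = -(ν * Real.sin s) := by
      rw [hν]; linear_combination (-(c ^ 2 + X ^ 2) * v s) * hcs + Real.cos s * hWs
    generalize Real.cos s = C at *
    generalize Real.sin s = S at *
    generalize u s = p at *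
    generalize v s = q at *
    have hA : 0 < c ^ 2 + X ^ 2 := by positivity
    have hc2 : 0 < c ^ 2 := by positivity
    have hτ : c ^ 2 + X ^ 2 * C ^ 2 = (c ^ 2 + X ^ 2) * C ^ 2 + c ^ 2 * S ^ 2 := by
      linear_combination (-c ^ 2) * hcs
    rw [hτ]
    generalize c ^ 2 + X ^ 2 = α at *
    generalize c ^ 2 = γ at *
    have h3 : α * γ * (p * C - q * S) = ν * (α * C ^ 2 + γ * S ^ 2) := by
      linear_combination α * C * h1 - γ * S * h2
    have h4 : ν ^ 2 * (α * C ^ 2 + γ * S ^ 2) = (α * γ) ^ 2 := by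
      linear_combination (α * γ) * hGs - α * (γ * p + ν * C) * h1 - γ * (α * q - ν * S) * h2
    refine mul_left_cancel₀ (show (α * γ) ^ 2 ≠ 0 by positivity) ?_
    rw [← mul_pow, h3]
    linear_combination (α * C ^ 2 + γ * S ^ 2) * h4

/-- A tangent arc gives only one of the two roots of the quadratic factor, namely `κ + 2 m cos θ ·
σ` with `κ = c² + ρ(m² + X²)` and `σ² = c² + X²ρ`. Taking the norm of the remainder at this root
removes the irrationality, and a sign argument at negative `ρ` then kills the remainder. -/
theorem splitsAs_of_tangent {ξ : Fin 6 → ℝ} {m X c a b : ℝ} {l : ℝ → ℝ} (hm0 : m ≠ 0)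
    (hX : 0 < X) (hc : 0 < c) (hm : m ^ 2 + X ^ 2 = 2 - √2 / 2) (hmX : X ^ 2 - m ^ 2 = rootB)
    (hab : a < b)
    (hl : ∀ s ∈ Set.Ioo a b, (l s - m * Real.cos s) ^ 2 = c ^ 2 + X ^ 2 * Real.cos s ^ 2)
    (hr : ∀ s ∈ Set.Ioo a b, polyP7 ξ (Real.cos s ^ 2) (l s ^ 2) = 0) :
    SplitsAs ξ (c ^ 2) (ξ 0 + ξ 1 + ξ 2 + ξ 3 + ξ 4 + ξ 5 - 2 * c ^ 2) := by
  -- `α ζ + β` is the remainder of the division of the cubic by the quadratic factor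
  obtain ⟨α, hα⟩ : ∃ α : ℝ → ℝ, α = fun ρ =>
      (ξ 0 + ρ) * (ξ 2 + ρ) + (ξ 0 + ρ) * (ξ 3 + ρ) + (ξ 0 + ρ) * (ξ 4 + ρ)
        + (ξ 0 + ρ) * (ξ 5 + ρ) + (ξ 1 + ρ) * (ξ 3 + ρ) + (ξ 1 + ρ) * (ξ 4 + ρ)
        + (ξ 1 + ρ) * (ξ 5 + ρ) + (ξ 2 + ρ) * (ξ 4 + ρ) + (ξ 2 + ρ) * (ξ 5 + ρ)
        + (ξ 3 + ρ) * (ξ 5 + ρ) - (c ^ 2 + ρ * rootB) ^ 2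
      - 2 * (c ^ 2 + ρ * (2 - √2 / 2)) *
        (ξ 0 + ξ 1 + ξ 2 + ξ 3 + ξ 4 + ξ 5 - 2 * c ^ 2 + ρ * (2 + √2)) := ⟨_, rfl⟩
  obtain ⟨β, hβ⟩ : ∃ β : ℝ → ℝ, β = fun ρ =>
      (ξ 0 + ξ 1 + ξ 2 + ξ 3 + ξ 4 + ξ 5 - 2 * c ^ 2 + ρ * (2 + √2)) * (c ^ 2 + ρ * rootB) ^ 2
      - ((ξ 0 + ρ) * (ξ 2 + ρ) * (ξ 4 + ρ) + (ξ 0 + ρ) * (ξ 2 + ρ) * (ξ 5 + ρ)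
        + (ξ 0 + ρ) * (ξ 3 + ρ) * (ξ 5 + ρ) + (ξ 1 + ρ) * (ξ 3 + ρ) * (ξ 5 + ρ)) := ⟨_, rfl⟩
  have hdiv : ∀ ρ ζ, polyP7 ξ ρ ζ =
      (ζ - (ξ 0 + ξ 1 + ξ 2 + ξ 3 + ξ 4 + ξ 5 - 2 * c ^ 2 + ρ * (2 + √2))) *
        (ζ ^ 2 - 2 * ζ * (c ^ 2 + ρ * (2 - √2 / 2)) + (c ^ 2 + ρ * rootB) ^ 2)
        + (α ρ * ζ + β ρ) := by
    intro ρ ζ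
    rw [polyP7_eq, hα, hβ]
    ring
  have haα : ∀ ρ, AnalyticAt ℝ α ρ := fun ρ => by rw [hα]; fun_prop
  have haβ : ∀ ρ, AnalyticAt ℝ β ρ := fun ρ => by rw [hβ]; fun_prop
  -- The norm of `α ζ + β` at the two roots of the quadratic factor, a polynomial in `ρ`.
  obtain ⟨H, hH⟩ : ∃ H : ℝ → ℝ, H = fun ρ => (β ρ + α ρ * (c ^ 2 + ρ * (2 - √2 / 2))) ^ 2
      - 4 * m ^ 2 * α ρ ^ 2 * (ρ * (c ^ 2 + X ^ 2 * ρ)) := ⟨_, rfl⟩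
  have haH : ∀ ρ, AnalyticAt ℝ H ρ := fun ρ => by
    have := haα ρ
    have := haβ ρ
    rw [hH]
    fun_prop
  have hIoo : ∀ {x y : ℝ}, x < y → ¬ (Set.Ioo x y).Countable := fun hxy h =>
    not_lt.2 (Cardinal.Real.Ioo_countable_iff.1 h) hxy
  have extend : ∀ {f : ℝ → ℝ} {x y : ℝ}, (∀ ρ, AnalyticAt ℝ f ρ) → x < y →
      (∀ ρ ∈ Set.Ioo x y, f ρ = 0) → ∀ ρ, f ρ = 0 := fun hf hxy h0 ρ =>
    AnalyticOnNhd.eqOn_zero_of_not_countable (fun s _ => hf s) isPreconnected_univ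
      (Set.subset_univ _) (hIoo hxy) h0 ρ (Set.mem_univ ρ)
  have hHI : ∀ s ∈ Set.Ioo a b, H (Real.cos s ^ 2) = 0 := by
    intro s hs
    have h1 := hr s hs
    have h2 := hl s hs
    rw [hdiv] at h1
    have hQ : (l s ^ 2) ^ 2 - 2 * l s ^ 2 * (c ^ 2 + Real.cos s ^ 2 * (2 - √2 / 2))
        + (c ^ 2 + Real.cos s ^ 2 * rootB) ^ 2 = 0 := by
      rw [← hm, ← hmX]
      linear_combination ((l s + m * Real.cos s) ^ 2 - (c ^ 2 + X ^ 2 * Real.cos s ^ 2)) * h2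
    rw [hQ, mul_zero, zero_add] at h1
    have hk : l s ^ 2 = c ^ 2 + Real.cos s ^ 2 * (2 - √2 / 2)
        + 2 * m * Real.cos s * (l s - m * Real.cos s) := by
      rw [← hm]
      linear_combination h2
    rw [hk] at h1
    simp only [hH]
    have h3 : β (Real.cos s ^ 2) + α (Real.cos s ^ 2) * (c ^ 2 + Real.cos s ^ 2 * (2 - √2 / 2))
        = -(2 * m * α (Real.cos s ^ 2) * Real.cos s * (l s - m * Real.cos s)) := by
      linear_combination h1
    rw [h3]
    linear_combination 4 * m ^ 2 * α (Real.cos s ^ 2) ^ 2 * Real.cos s ^ 2 * h2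
  have hHcos : ∀ s, H (Real.cos s ^ 2) = 0 := by
    refine extend (fun s => ?_) hab hHI
    have h1 : AnalyticAt ℝ (fun s => Real.cos s ^ 2) s := Real.analyticAt_cos.pow 2
    exact (haH _).comp_of_eq h1 rfl
  have hH0 : ∀ ρ, H ρ = 0 := by
    refine extend haH one_pos fun ρ hρ => ?_
    have := hHcos (Real.arccos √ρ)
    rwa [Real.cos_arccos (by linarith [Real.sqrt_nonneg ρ]) (Real.sqrt_le_one.2 hρ.2.le),
      Real.sq_sqrt hρ.1.le] at this
  have hlt : -(c ^ 2 / X ^ 2) < 0 := by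
    have : 0 < c ^ 2 / X ^ 2 := by positivity
    linarith
  -- On this interval `ρ (c² + X² ρ) < 0`, so `H = 0` is a vanishing sum of two nonnegative terms;
  -- `m ≠ 0` then yields `α = 0`.
  have hneg : ∀ ρ ∈ Set.Ioo (-(c ^ 2 / X ^ 2)) 0, α ρ = 0 ∧ β ρ = 0 := by
    intro ρ hρ
    have h1 := hH0 ρ
    simp only [hH] at h1
    have h2 : 0 < c ^ 2 + X ^ 2 * ρ := by
      have := hρ.1
      rw [neg_lt, lt_div_iff₀ (by positivity)] at this
      linarith
    have h3 : 0 < -ρ * (c ^ 2 + X ^ 2 * ρ) := mul_pos (by linarith [hρ.2]) h2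
    have h4 : 0 ≤ 4 * m ^ 2 * α ρ ^ 2 * (-ρ * (c ^ 2 + X ^ 2 * ρ)) := by positivity
    have h5 := sq_nonneg (β ρ + α ρ * (c ^ 2 + ρ * (2 - √2 / 2)))
    have h6 : 4 * m ^ 2 * α ρ ^ 2 * (-ρ * (c ^ 2 + X ^ 2 * ρ)) = 0 :=
      le_antisymm (by linarith) h4
    have h7 : α ρ = 0 := by simpa [hm0, h3.ne', mul_eq_zero, hρ.2.ne, h2.ne'] using h6
    refine ⟨h7, ?_⟩
    rw [h7] at h1
    simpa using h1
  have hα0 := extend haα hlt fun ρ hρ => (hneg ρ hρ).1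
  have hβ0 := extend haβ hlt fun ρ hρ => (hneg ρ hρ).2
  intro ρ ζ
  rw [hdiv, hα0, hβ0]
  ring

/-- If the Kippenhahn curve of a reciprocal matrix contains an ellipse with the center `m` and the
focal distance `2 X`, then the cubic of the matrix splits formally. -/
theorem splitsAs_of_ellipse_subset {A : Matrix (Fin 7) (Fin 7) ℂ} (hA : IsReciprocalZeroDiag A)
    {m X c : ℝ} (hm0 : m ≠ 0) (hX : 0 < X) (hc : 0 < c) (hm : m ^ 2 + X ^ 2 = 2 - √2 / 2)
    (hmX : X ^ 2 - m ^ 2 = rootB)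
    (hE : ellipse ((m + X : ℝ) : ℂ) ((m - X : ℝ) : ℂ) c ⊆ kippenhahnCurve A) :
    ∃ D, SplitsAs (xi A) (c ^ 2) D := by
  obtain ⟨a, b, l, hab, hl, hr, hS⟩ :=
    exists_arc_of_subset_kippenhahnCurve (not_countable_ellipse hX hc) hE
  have ht := sq_eq_of_envelope_meets_ellipse hX hc hl hS
  refine ⟨_, splitsAs_of_tangent hm0 hX hc hm hmX hab ht fun s hs => ?_⟩
  have h1 := hr s hs
  rw [kippenhahnPoly_eq hA, Complex.ofReal_eq_zero, neg_mul, neg_eq_zero] at h1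
  -- The arc does not come from the root `0`: that would give `c² + rootB cos² s = 0`.
  refine (mul_eq_zero.1 h1).resolve_left fun h0 => ?_
  have h2 := ht s hs
  rw [h0] at h2
  have h3 : c ^ 2 + rootB * Real.cos s ^ 2 = 0 := by
    rw [← hmX]
    linear_combination -h2
  have : 0 < rootB := by linarith [rootB_bounds.1]
  have : 0 < c ^ 2 + rootB * Real.cos s ^ 2 := by positivity
  exact this.ne' h3

/-- The Kippenhahn curve in the case of a formal splitting. -/
theorem kippenhahnCurve_eq_of_splitsAs {A : Matrix (Fin 7) (Fin 7) ℂ}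
    (hA : IsReciprocalZeroDiag A) {m X Y c d : ℝ} (hX : 0 < X) (hY : 0 < Y) (hc : 0 < c)
    (hd : 0 < d) (hm : m ^ 2 + X ^ 2 = 2 - √2 / 2) (hmX : X ^ 2 - m ^ 2 = rootB)
    (hY2 : Y ^ 2 = 2 + √2) (h : SplitsAs (xi A) (c ^ 2) (d ^ 2)) :
    kippenhahnCurve A = ellipse ((m + X : ℝ) : ℂ) ((m - X : ℝ) : ℂ) c ∪
      {z | -z ∈ ellipse ((m + X : ℝ) : ℂ) ((m - X : ℝ) : ℂ) c} ∪
      ellipse (Y : ℂ) ((-Y : ℝ) : ℂ) d ∪ {0} := by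
  have hsq : ∀ {p q r : ℝ}, 0 < r → ((p - q) ^ 2 = r ↔ p = q + 1 * √r ∨ p = q + -1 * √r) := by
    intro p q r hr
    rw [← Real.sq_sqrt hr.le, sq_eq_sq_iff_eq_or_eq_neg, Real.sqrt_sq (Real.sqrt_nonneg r)]
    constructor <;> rintro (h | h)
    · left; linarith
    · right; linarith
    · left; linarith
    · right; linarith
  -- Center, half focal distance and minor half-axis of `E`, `-E`, `E₀`. The Boolean in the index of
  -- `g` is the sign of the square root, and `none` is the root `0`.
  let par : Fin 3 → ℝ × ℝ × ℝ := ![(m, X, c), (-m, X, c), (0, Y, d)]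
  let g : Option (Fin 3 × Bool) → ℝ → ℝ := fun k => k.elim (fun _ => 0) fun p =>
    ellipseSupport (par p.1).1 (par p.1).2.1 (par p.1).2.2 (bif p.2 then 1 else -1)
  have hpar : ∀ i, 0 < (par i).2.1 ∧ 0 < (par i).2.2 := by
    intro i
    fin_cases i
    exacts [⟨hX, hc⟩, ⟨hX, hc⟩, ⟨hY, hd⟩]
  have hg : ∀ k θ, AnalyticAt ℝ (g k) θ := by
    rintro (_ | p) θ
    · exact analyticAt_const
    · exact analyticAt_ellipseSupport (hpar _).2 _ _
  have hroots : ∀ x θ, kippenhahnPoly A x θ = 0 ↔ ∃ k, x = g k θ := by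
    intro x θ
    have hfac : x * polyP7 (xi A) (Real.cos θ ^ 2) (x ^ 2) = x *
        (((x - m * Real.cos θ) ^ 2 - (c ^ 2 + X ^ 2 * Real.cos θ ^ 2)) *
        ((x - -m * Real.cos θ) ^ 2 - (c ^ 2 + X ^ 2 * Real.cos θ ^ 2)) *
        ((x - 0 * Real.cos θ) ^ 2 - (d ^ 2 + Y ^ 2 * Real.cos θ ^ 2))) := by
      rw [h, ← hm, ← hmX, hY2]
      ring
    rw [kippenhahnPoly_eq hA, Complex.ofReal_eq_zero, neg_mul, neg_eq_zero, hfac, mul_eq_zero,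
      mul_eq_zero, mul_eq_zero, sub_eq_zero, sub_eq_zero, sub_eq_zero, hsq (by positivity),
      hsq (by positivity), hsq (by positivity)]
    constructor
    · rintro (h | ((h | h) | (h | h)) | (h | h))
      exacts [⟨none, h⟩, ⟨some (0, true), h⟩, ⟨some (0, false), h⟩, ⟨some (1, true), h⟩,
        ⟨some (1, false), h⟩, ⟨some (2, true), h⟩, ⟨some (2, false), h⟩]
    · rintro ⟨_ | ⟨i, _ | _⟩, hk⟩
      · exact Or.inl hk
      · fin_cases i
        exacts [Or.inr (Or.inl (Or.inl (Or.inr hk))), Or.inr (Or.inl (Or.inr (Or.inr hk))),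
          Or.inr (Or.inr (Or.inr hk))]
      · fin_cases i
        exacts [Or.inr (Or.inl (Or.inl (Or.inl hk))), Or.inr (Or.inl (Or.inr (Or.inl hk))),
          Or.inr (Or.inr (Or.inl hk))]
  have hzero : ∀ θ, envelopePoint (fun _ => 0) θ = 0 := fun θ => by simp [envelopePoint]
  have hell : ∀ i z, z ∈ ellipse (((par i).1 + (par i).2.1 : ℝ) : ℂ)
      (((par i).1 - (par i).2.1 : ℝ) : ℂ) (par i).2.2 ↔
      ∃ b θ, z = envelopePoint (g (some (i, b))) θ := by
    intro i z
    constructor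
    · intro hz
      exact ⟨true, (mem_ellipse_iff_exists (hpar i).1 (hpar i).2 (one_pow 2) z).1 hz⟩
    · rintro ⟨_ | _, hz⟩
      · exact (mem_ellipse_iff_exists (hpar i).1 (hpar i).2 (by norm_num) z).2 hz
      · exact (mem_ellipse_iff_exists (hpar i).1 (hpar i).2 (by norm_num) z).2 hz
  have hneg : ∀ z : ℂ, -z ∈ ellipse ((m + X : ℝ) : ℂ) ((m - X : ℝ) : ℂ) c ↔
      z ∈ ellipse ((-m + X : ℝ) : ℂ) ((-m - X : ℝ) : ℂ) c := by
    intro z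
    rw [mem_ellipse_iff hX hc, mem_ellipse_iff hX hc, Complex.neg_re, Complex.neg_im, neg_sq,
      show (-z.re - m) ^ 2 = (z.re - -m) ^ 2 by ring]
  have hY0 : ellipse (Y : ℂ) ((-Y : ℝ) : ℂ) d
      = ellipse ((0 + Y : ℝ) : ℂ) ((0 - Y : ℝ) : ℂ) d := by rw [zero_add, zero_sub]
  rw [kippenhahnCurve_eq_of_roots g hg hroots, hY0]
  ext z
  simp only [Set.mem_union, Set.mem_ofPred_eq, Set.mem_singleton_iff, hneg]
  constructor
  · rintro ⟨_ | ⟨i, b⟩, θ, hz⟩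
    · exact Or.inr (hz.trans (hzero θ))
    · have := (hell i z).2 ⟨b, θ, hz⟩
      left
      fin_cases i
      exacts [Or.inl (Or.inl this), Or.inl (Or.inr this), Or.inr this]
  · rintro (((hz | hz) | hz) | hz)
    · obtain ⟨b, θ, h⟩ := (hell 0 z).1 hz
      exact ⟨_, θ, h⟩
    · obtain ⟨b, θ, h⟩ := (hell 1 z).1 hz
      exact ⟨_, θ, h⟩
    · obtain ⟨b, θ, h⟩ := (hell 2 z).1 hz
      exact ⟨_, θ, h⟩
    · exact ⟨none, 0, hz.trans (hzero 0).symm⟩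

/-! ### Symmetry under negation, and assembly of the theorem -/

theorem neg_mem_kippenhahnCurve {A : Matrix (Fin 7) (Fin 7) ℂ} (hA : IsReciprocalZeroDiag A)
    {z : ℂ} (hz : z ∈ kippenhahnCurve A) : -z ∈ kippenhahnCurve A := by
  obtain ⟨θ, l, hl, hr, rfl⟩ := hz
  refine ⟨θ, -l, hl.neg, hr.mono fun s hs => ?_, ?_⟩
  · rw [kippenhahnPoly_eq hA, Complex.ofReal_eq_zero] at hs ⊢
    rw [Pi.neg_apply, neg_sq]
    linear_combination -hs
  · rw [deriv.neg', Pi.neg_apply]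
    push_cast
    ring

theorem mem_ellipse_neg_iff (f g z : ℂ) (c : ℝ) : z ∈ ellipse f g c ↔ -z ∈ ellipse (-g) (-f) c := by
  simp only [ellipse, Set.mem_ofPred_eq, dist_neg_neg, dist_comm g f, add_comm (dist z g)]

theorem splitsAs_smul_xiVec {t : ℝ} (ht : 0 < t) (j : Fin 6) :
    SplitsAs (t • xiVec j) ((√t * halfE j) ^ 2) ((√t * halfE0 j) ^ 2) := by
  rw [mul_pow, mul_pow, Real.sq_sqrt ht.le]
  exact (splitsAs_xiVec j).smul ht.ne'

theorem polyP7_xiVec3 {p X : ℝ} (h1 : p + X = √2) (h2 : p - X = -√(2 - √2)) (ρ ζ : ℝ) :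
    polyP7 xiVec3 ρ ζ =
      (ζ - (halfE03 ^ 2 + ρ * √(2 + √2) ^ 2)) *
        (ζ ^ 2 - 2 * ζ * (halfE3 ^ 2 + ρ * (p ^ 2 + X ^ 2))
          + (halfE3 ^ 2 + ρ * (X ^ 2 - p ^ 2)) ^ 2) := by
  have bS := sqrt_two_bounds
  have e1 : √(2 - √2) ^ 2 = 2 - √2 := Real.sq_sqrt (by linarith)
  have e2 : √(2 + √2) ^ 2 = 2 + √2 := Real.sq_sqrt (by linarith)
  have e3 : p ^ 2 + X ^ 2 = 2 - √2 / 2 := by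
    have : p ^ 2 + X ^ 2 = ((p + X) ^ 2 + (p - X) ^ 2) / 2 := by ring
    rw [this, h1, h2, neg_sq, e1, sq_sqrt_two]
    ring
  have e4 : X ^ 2 - p ^ 2 = rootB := by
    have : X ^ 2 - p ^ 2 = -((p + X) * (p - X)) := by ring
    rw [this, h1, h2, sqrt_two_sub_sqrt_two]
    linear_combination rootB / 2 * sq_sqrt_two
  rw [e2, e3, e4, splitsAs_xiVec3]

theorem mainTheorem8 :
    -- decimal values of the first three vectors, and of the half-axes for the third one
    (∀ (j : Fin 3) (i : Fin 6),
      |xiVec (j.castLE (by norm_num)) i - xiVecApprox j i| ≤ 5 / 10 ^ 6) ∧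
    |halfE3 - 1.20323| ≤ 5 / 10 ^ 6 ∧ |halfE03 - 1.44257| ≤ 5 / 10 ^ 6 ∧
    -- the third vector is a (formal) solution: its cubic splits, with the stated half-axes,
    -- `p + X = √2`, `X - p = √(2 - √2)` and `X₀ = √(2 + √2)`
    (∀ p X : ℝ, p + X = √2 → p - X = -√(2 - √2) → ∀ ρ ζ : ℝ,
      polyP7 xiVec3 ρ ζ =
        (ζ - (halfE03 ^ 2 + ρ * √(2 + √2) ^ 2)) *
          (ζ ^ 2 - 2 * ζ * (halfE3 ^ 2 + ρ * (p ^ 2 + X ^ 2))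
            + (halfE3 ^ 2 + ρ * (X ^ 2 - p ^ 2)) ^ 2)) ∧
    ∀ A : Matrix (Fin 7) (Fin 7) ℂ, IsReciprocalZeroDiag A →
      -- the criterion
      (ContainsEllipse (kippenhahnCurve A) ((√(2 - √2) : ℝ) : ℂ) ((-√2 : ℝ) : ℂ) ↔
        ∃ t : ℝ, 0 < t ∧ ∃ j : Fin 6, xi A = t • xiVec j) ∧
      -- the equivalent choice of the foci
      (ContainsEllipse (kippenhahnCurve A) ((√(2 - √2) : ℝ) : ℂ) ((-√2 : ℝ) : ℂ) ↔
        ContainsEllipse (kippenhahnCurve A) ((√2 : ℝ) : ℂ) ((-√(2 - √2) : ℝ) : ℂ)) ∧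
      -- the whole curve and the minor half-axes
      (∀ (t : ℝ) (j : Fin 6) (c : ℝ), 0 < t → xi A = t • xiVec j → 0 < c →
        ellipse ((√(2 - √2) : ℝ) : ℂ) ((-√2 : ℝ) : ℂ) c ⊆ kippenhahnCurve A →
        c = √t * halfE j ∧ 0 < halfE0 j ∧
        kippenhahnCurve A =
          ellipse ((√(2 - √2) : ℝ) : ℂ) ((-√2 : ℝ) : ℂ) c ∪
            {z | -z ∈ ellipse ((√(2 - √2) : ℝ) : ℂ) ((-√2 : ℝ) : ℂ) c} ∪
            ellipse ((√(2 + √2) : ℝ) : ℂ) ((-√(2 + √2) : ℝ) : ℂ) (√t * halfE0 j) ∪ {0}) := by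
  refine ⟨xiVec_approx, halfE3_approx, halfE03_approx,
    fun p X h1 h2 ρ ζ => polyP7_xiVec3 h1 h2 ρ ζ, fun A hA => ?_⟩
  have bS := sqrt_two_bounds
  have bSB := sqrt_two_mul_rootB_bounds
  -- Center and half focal distance of `E`.
  obtain ⟨m, hmdef⟩ : ∃ m, m = (√(2 - √2) - √2) / 2 := ⟨_, rfl⟩
  obtain ⟨X, hXdef⟩ : ∃ X, X = (√(2 - √2) + √2) / 2 := ⟨_, rfl⟩
  have f1 : √(2 - √2) = m + X := by rw [hmdef, hXdef]; ring
  have f2 : -√2 = m - X := by rw [hmdef, hXdef]; ring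
  have e1 : √(2 - √2) ^ 2 = 2 - √2 := Real.sq_sqrt (by linarith)
  have hm : m ^ 2 + X ^ 2 = 2 - √2 / 2 := by
    rw [hmdef, hXdef]
    linear_combination (e1 + sq_sqrt_two) / 2
  have hmX : X ^ 2 - m ^ 2 = rootB := by
    rw [hmdef, hXdef, sqrt_two_sub_sqrt_two]
    linear_combination rootB / 2 * sq_sqrt_two
  have hm0 : m ≠ 0 := by
    intro h
    rw [hmdef, sqrt_two_sub_sqrt_two] at h
    linarith
  have hX : 0 < X := by
    rw [hXdef, sqrt_two_sub_sqrt_two]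
    linarith
  have hY : 0 < √(2 + √2) := Real.sqrt_pos.2 (by linarith)
  have hY2 : √(2 + √2) ^ 2 = 2 + √2 := Real.sq_sqrt (by linarith)
  have hcurve : ∀ {t c : ℝ} {j : Fin 6}, 0 < t → xi A = t • xiVec j → c = √t * halfE j →
      kippenhahnCurve A = ellipse ((√(2 - √2) : ℝ) : ℂ) ((-√2 : ℝ) : ℂ) c ∪
        {z | -z ∈ ellipse ((√(2 - √2) : ℝ) : ℂ) ((-√2 : ℝ) : ℂ) c} ∪
        ellipse ((√(2 + √2) : ℝ) : ℂ) ((-√(2 + √2) : ℝ) : ℂ) (√t * halfE0 j) ∪ {0} := by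
    rintro t c j ht hξ rfl
    rw [f1, f2]
    have ht' := Real.sqrt_pos.2 ht
    refine kippenhahnCurve_eq_of_splitsAs hA hX hY (mul_pos ht' (halfE_pos j))
      (mul_pos ht' (halfE0_pos j)) hm hmX hY2 ?_
    rw [hξ]
    exact splitsAs_smul_xiVec ht j
  refine ⟨⟨?_, ?_⟩, ?_, ?_⟩
  · rintro ⟨c, hc, hE⟩
    rw [f1, f2] at hE
    obtain ⟨D, hD⟩ := splitsAs_of_ellipse_subset hA hm0 hX hc hm hmX hE
    have hc2 : 0 < c ^ 2 := by positivity
    obtain ⟨j, hj⟩ := hD.exists_eq_smul (fun i => by rw [xi]; positivity) hc2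
    exact ⟨c ^ 2, hc2, j, hj⟩
  · rintro ⟨t, ht, j, hξ⟩
    refine ⟨√t * halfE j, mul_pos (Real.sqrt_pos.2 ht) (halfE_pos j), ?_⟩
    rw [hcurve ht hξ rfl]
    exact fun z hz => Or.inl (Or.inl (Or.inl hz))
  · have hsymm : ∀ f g : ℂ, ContainsEllipse (kippenhahnCurve A) f g →
        ContainsEllipse (kippenhahnCurve A) (-g) (-f) := by
      rintro f g ⟨c, hc, hE⟩
      refine ⟨c, hc, fun z hz => ?_⟩
      have := neg_mem_kippenhahnCurve hA (hE ((mem_ellipse_neg_iff f g (-z) c).2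
        (by rwa [neg_neg])))
      rwa [neg_neg] at this
    constructor <;> intro h <;> simpa using hsymm _ _ h
  · intro t j c ht hξ hc hE
    -- The splitting coming from the given ellipse and the known one for `t • xiVec j` must share
    -- the value `C`.
    have hcE : c = √t * halfE j := by
      rw [f1, f2] at hE
      obtain ⟨D, hD⟩ := splitsAs_of_ellipse_subset hA hm0 hX hc hm hmX hE
      rw [hξ] at hD
      exact (pow_left_inj₀ hc.le (mul_nonneg (Real.sqrt_nonneg t) (halfE_pos j).le)
        two_ne_zero).1 (hD.unique (splitsAs_smul_xiVec ht j))
    exact ⟨hcE, halfE0_pos j, hcurve ht hξ hcE⟩
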